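/- Let $m,n\ge 0$ be integers, let $\tau\colon\mathbb C\to\mathbb C$ be an anti-holomorphic involution, let $\sigma\in\mathbb C$ with $|\sigma|=1$, and let $B$ be a complex $n\times n$ matrix with simple spectrum (all roots of its characteristic polynomial are distinct). Denote by $\widetilde{\mathcal P}_{m,n}(B,\tau,\sigma)$ the set of matrix polynomials $L_\lambda=B_m\lambda^m+\dots+B_0$ with coefficients in $\mathfrak{gl}(n,\mathbb C)$ such that $B_m=B$ and $L_{\tau(\lambda)}=\sigma L_\lambda^*$ for all $\lambda\in\mathbb C$, where $*$ is the conjugate transpose. The spectral curve of $L_\lambda$ is the affine plane curve $C(L_\lambda)=\{(\lambda,\mu)\in\mathbb C^2 : \det(L_\lambda-\mu E)=0\}$, and $\widehat\tau(\lambda,\mu)=(\tau(\lambda),\sigma\bar\mu)$. Let $L^0_\lambda\in\widetilde{\mathcal P}_{m,n}(B,\tau,\sigma)$ and $C=C(L^0_\lambda)$. Assume that 1. all singular points of $C$ are fixed points of $\widehat\tau$; 2. each irreducible component of $C$ is a smooth affine curve whose normalized compactification has genus zero; 3. at every common point of two distinct irreducible components of $C$ their intersection multiplicity is at most $2$. Then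 the isospectral set $\{L_\lambda\in\widetilde{\mathcal P}_{m,n}(B,\tau,\sigma) : C(L_\lambda)=C\}$ coincides with the orbit $\{Q^{-1}L^0_\lambda Q : Q\in \mathrm U(n),\ QB=BQ\}$ of $L^0_\lambda$ under the gauge group. In particular, every $L_\lambda\in\widetilde{\mathcal P}_{m,n}(B,\tau,\sigma)$ with $C(L_\lambda)=C$ is of the form $Q^{-1}L^0_\lambda Q$ with a unitary matrix $Q$ commuting with $B$. -/

import Mathlib

open Polynomial
open scoped Polynomial.Bivariate Matrix ComplexConjugate

noncomputable section

namespace Spectral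

/-! ### Genus of an algebraic function field over `ℂ` -/

section Genus

variable (F : Type) [Field F] [Algebra ℂ F]

/-- Places of `F/ℂ`: the nontrivial valuation rings of `F` containing the constants.
For the function field of an irreducible curve these are the points of its smooth projective
model (the normalized compactification); all of them have residue field `ℂ`, i.e. degree `1`. -/
def Place : Type :=
  {A : ValuationSubring F // (∀ c : ℂ, algebraMap ℂ F c ∈ A) ∧ A ≠ ⊤}

/-- Divisors: finite formal sums of places. -/
abbrev Divisor : Type := Place F →₀ ℤ

variable {F}

/-- Degree of a divisor (each place has degree `1`, as `ℂ` is algebraically closed). -/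
def Divisor.degree (D : Divisor F) : ℤ := D.sum fun _ k => k

/-- The Riemann-Roch space `L(D)`: all `x` with `ord_v x ≥ - D v` at every place `v`. The order
condition is written with a local parameter `t` at `v` (an irreducible element of the
valuation ring): `t ^ (D v) * x` is regular at `v`. -/
def riemannRochSpace (D : Divisor F) : Submodule ℂ F where
  carrier := {x | ∀ (v : Place F) (t : v.1), Irreducible t → (t : F) ^ (D v) * x ∈ v.1}
  zero_mem' := fun v t _ => by simp
  add_mem' := fun {x y} hx hy v t ht => by
    rw [mul_add]
    exact v.1.add_mem _ _ (hx v t ht) (hy v t ht)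
  smul_mem' := fun c x hx v t ht => by
    rw [Algebra.smul_def, mul_left_comm]
    exact v.1.mul_mem _ _ (v.2.1 c) (hx v t ht)

variable (F)

/-- The genus of the function field `F/ℂ`: the maximum of `deg D + 1 - dim L(D)` over all
divisors `D`. The value at `D = 0` is `0`, so truncating negative values at `0` does not change
the maximum. -/
def genus : ℕ∞ :=
  ⨆ D : Divisor F, ((D.degree + 1 - (Module.finrank ℂ (riemannRochSpace D) : ℤ)).toNat : ℕ∞)

end Genus

/-! ### Affine plane curves

An element `f : ℂ[X][Y]` is a polynomial `f(λ, μ)`: the inner variable is `λ`, the outer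
variable is `μ`, and `f.evalEval a b = f(a, b)`. -/

/-- The points of the curve `f = 0`. -/
def zeroSet (f : ℂ[X][Y]) : Set (ℂ × ℂ) := {p | f.evalEval p.1 p.2 = 0}

/-- The value of `∂f/∂λ` at `p`. -/
def partialFst (f : ℂ[X][Y]) (p : ℂ × ℂ) : ℂ := (derivative (f.eval (C p.2))).eval p.1

/-- The value of `∂f/∂μ` at `p`. -/
def partialSnd (f : ℂ[X][Y]) (p : ℂ × ℂ) : ℂ := (derivative f).evalEval p.1 p.2

/-- The singular points of the curve `f = 0` (for squarefree `f`). -/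
def singularSet (f : ℂ[X][Y]) : Set (ℂ × ℂ) :=
  {p | p ∈ zeroSet f ∧ partialFst f p = 0 ∧ partialSnd f p = 0}

theorem isPrime_span {f : ℂ[X][Y]} (hf : Irreducible f) : (Ideal.span {f}).IsPrime :=
  (Ideal.span_singleton_prime hf.ne_zero).2 hf.prime

/-- The genus of (the normalized compactification of) the irreducible curve `f = 0`: the genus of
its function field, the fraction field of `ℂ[λ, μ] / (f)`. -/
def curveGenus (f : ℂ[X][Y]) (hf : Irreducible f) : ℕ∞ :=
  haveI := isPrime_span hf
  genus (FractionRing (ℂ[X][Y] ⧸ Ideal.span {f}))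

/-- The maximal ideal of the point `p` in `ℂ[λ, μ]`. -/
abbrev pointIdeal (p : ℂ × ℂ) : Ideal ℂ[X][Y] := RingHom.ker (evalEvalRingHom p.1 p.2)

instance (p : ℂ × ℂ) : (pointIdeal p).IsPrime := RingHom.ker_isPrime _

/-- `dim_ℂ A_𝔭 / (f, g)`, where `A_𝔭` is the localization of `A` at the prime ideal `𝔭`. -/
def localMultiplicity {A : Type} [CommRing A] [Algebra ℂ A] (𝔭 : Ideal A) [𝔭.IsPrime]
    (f g : A) : ℕ∞ :=
  Cardinal.toENat (Module.rank ℂ (Localization.AtPrime 𝔭 ⧸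
    Ideal.span {algebraMap A (Localization.AtPrime 𝔭) f, algebraMap A (Localization.AtPrime 𝔭) g}))

/-- The order of intersection of `f = 0` and `g = 0` at `p`, i.e. the intersection multiplicity
`dim_ℂ O_p / (f, g)`, where `O_p` is the local ring of the affine plane at `p`. -/
def intersectionOrder (f g : ℂ[X][Y]) (p : ℂ × ℂ) : ℕ∞ := localMultiplicity (pointIdeal p) f g

/-! ### Matrix polynomials and their spectral curves -/

variable {n : ℕ}

/-- The matrix `L_z`. -/
def evalAt (L : Matrix (Fin n) (Fin n) ℂ[X]) (z : ℂ) : Matrix (Fin n) (Fin n) ℂ :=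
  L.map (Polynomial.eval z)

/-- The matrix coefficient of `λ ^ k` in `L_λ`. -/
def matrixCoeff (L : Matrix (Fin n) (Fin n) ℂ[X]) (k : ℕ) : Matrix (Fin n) (Fin n) ℂ :=
  L.map fun q => q.coeff k

/-- The polynomial `P(λ, μ) = det (L_λ - μ E)`. -/
def spectralPoly (L : Matrix (Fin n) (Fin n) ℂ[X]) : ℂ[X][Y] :=
  (L.map C - (Y : ℂ[X][Y]) • (1 : Matrix (Fin n) (Fin n) ℂ[X][Y])).det

/-- The spectral curve `det (L_λ - μ E) = 0` in `ℂ²`. -/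
def spectralCurve (L : Matrix (Fin n) (Fin n) ℂ[X]) : Set (ℂ × ℂ) := zeroSet (spectralPoly L)

/-- `f = 0` is an irreducible component of the spectral curve of `L`. Two such polynomials
define the same component exactly when they are associated. -/
def IsComponent (L : Matrix (Fin n) (Fin n) ℂ[X]) (f : ℂ[X][Y]) : Prop :=
  Irreducible f ∧ f ∣ spectralPoly L

/-- An anti-holomorphic involution of `ℂ`. -/
structure IsAntiholomorphicInvolution (τ : ℂ → ℂ) : Prop where
  involutive : Function.Involutive τ
  antiholomorphic : Differentiable ℂ fun z => conj (τ z)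

/-- The matrix polynomials `L_λ = B λ ^ m + ⋯ + B_0` with
`L_{τ(λ)} = σ L_λ^*`. -/
def realPencils (m : ℕ) (B : Matrix (Fin n) (Fin n) ℂ) (τ : ℂ → ℂ) (σ : ℂ) :
    Set (Matrix (Fin n) (Fin n) ℂ[X]) :=
  {L | (∀ k, m < k → matrixCoeff L k = 0) ∧ matrixCoeff L m = B ∧
    ∀ z, evalAt L (τ z) = σ • (evalAt L z)ᴴ}

/-- The map `(λ, μ) ↦ (τ(λ), σ μ̄)`. -/
def tauHat (τ : ℂ → ℂ) (σ : ℂ) (p : ℂ × ℂ) : ℂ × ℂ := (τ p.1, σ * conj p.2)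

/-- The matrix polynomials in `realPencils m B τ σ` with the same spectral curve as `L₀`. -/
def isospectralSet (m : ℕ) (B : Matrix (Fin n) (Fin n) ℂ) (τ : ℂ → ℂ) (σ : ℂ)
    (L₀ : Matrix (Fin n) (Fin n) ℂ[X]) : Set (Matrix (Fin n) (Fin n) ℂ[X]) :=
  {L | L ∈ realPencils m B τ σ ∧ spectralCurve L = spectralCurve L₀}

/-- The orbit of `L₀` under `L ↦ Q⁻¹ L Q`, where `Q` runs over the unitary matrices commuting
with `B`. Scalar matrices act trivially, so this is also the orbit of the group of such `Q`
modulo scalars. -/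
def gaugeOrbit (B : Matrix (Fin n) (Fin n) ℂ) (L₀ : Matrix (Fin n) (Fin n) ℂ[X]) :
    Set (Matrix (Fin n) (Fin n) ℂ[X]) :=
  {L | ∃ Q ∈ Matrix.unitaryGroup (Fin n) ℂ, Commute Q B ∧
    L = (Q⁻¹).map C * L₀ * Q.map C}

end Spectral

end

/-! A matrix polynomial is reconstructed from its spectral curve up to conjugation by a constant
matrix; the reality condition then makes the conjugation unitary.

Simplicity of the spectrum of `B` gives `n` distinct expansions `μ = λ ^ m ν(1 / λ)` at infinity
(`exists_branches`). Hence the characteristic polynomial is generically separable and determined by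
the curve (`charpoly_eq_of_spectralCurve_eq`), and a component `f_i` has exactly `deg f_i` points at
infinity. Smoothness and genus zero give on each component a regular function `t_i` whose only pole
is a simple one at a chosen point at infinity (`nonempty_coordinate`). A row eigenvector of `L` on
the component can be written with coprime polynomials in `t_i` of largest degree `N_i`
(`nonempty_eigenRow`). Pairing column vectors with it turns `L` into multiplication by `μ`.

The heart of the proof is that the pairings on all components can be prescribed independently
(`exists_pairing_eq`). For this the spectral projector of each component, a priori rational in `λ`,
must have no poles. Poles can only lie over intersections of components, hence over fixed points of
`τ`. At a fixed point `L_λ = σ L_λ^*` is normal, so its spectral projectors are orthogonal and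
bounded by `1`. Since `τ` is affine in `λ̄`, its fixed points are not isolated, and boundedness
excludes poles (`exists_polynomial_projector`).

A vector whose pairings are polynomials in `t_i` of degree at most `N_i` has no pole at infinity,
because the eigenvectors tend there to an eigenbasis of `B`; so it is constant
(`exists_C_of_pairing_eq`). A dimension count yields `N_i + 1 = deg f_i` (`N_succ_eq_natDegree`), so
`ℂ ^ n` is identified with the sum of the spaces of polynomials of degree less than `deg f_i`, which
depends only on the curve. Comparing the identifications for `L` and `L₀` gives a constant
invertible `Q` with `Q L = L₀ Q` (`exists_conjugation`). By reality `Qᴴ Q` commutes with `L`, so the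
unitary factor of `Q` conjugates as well (`exists_unitary_conjugation`). -/

noncomputable section

namespace Spectral

open scoped LaurentSeries PowerSeries

/-! ### Laurent series at infinity -/

/-- The inclusion of power series into Laurent series. -/
abbrev toLaurent : ℂ⟦X⟧ →+* ℂ⸨X⸩ := algebraMap ℂ⟦X⟧ ℂ⸨X⸩

/-- The local parameter `s = 1 / λ`. -/
def param : ℂ⸨X⸩ := toLaurent PowerSeries.X

/-- The Laurent series without pole. -/
def regular : ValuationSubring ℂ⸨X⸩ :=
  { toLaurent.range with
    mem_or_inv_mem' := fun x => by
      rcases ValuationRing.isInteger_or_isInteger ℂ⟦X⟧ x with h | h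
      · exact Or.inl h
      · exact Or.inr h }

/-- The expansion of a polynomial in `λ` in powers of `s = 1 / λ`. -/
def atInfinity : ℂ[X] →ₐ[ℂ] ℂ⸨X⸩ := aeval param⁻¹

theorem toLaurent_mem (y : ℂ⟦X⟧) : toLaurent y ∈ regular := ⟨y, rfl⟩

theorem toLaurent_injective : Function.Injective toLaurent :=
  IsFractionRing.injective ℂ⟦X⟧ ℂ⸨X⸩

theorem param_ne_zero : param ≠ 0 := by
  unfold param
  rw [Ne, map_eq_zero_iff _ toLaurent_injective]
  exact PowerSeries.X_ne_zero

theorem param_mem : param ∈ regular := toLaurent_mem _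

theorem algebraMap_eq_toLaurent (c : ℂ) :
    algebraMap ℂ ℂ⸨X⸩ c = toLaurent (PowerSeries.C c) := by
  rw [HahnSeries.algebraMap_apply']
  rfl

theorem algebraMap_mem_regular (c : ℂ) : algebraMap ℂ ℂ⸨X⸩ c ∈ regular := by
  rw [algebraMap_eq_toLaurent]; exact toLaurent_mem _

theorem atInfinity_X : atInfinity X = param⁻¹ := aeval_X _

theorem exists_param_pow_mul_mem (x : ℂ⸨X⸩) : ∃ r : ℕ, param ^ r * x ∈ regular := by
  obtain ⟨⟨a, b, r, rfl⟩, h⟩ :=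
    IsLocalization.surj (Submonoid.powers (PowerSeries.X : ℂ⟦X⟧)) x
  refine ⟨r, a, ?_⟩
  simp only at h
  rw [← h, map_pow, mul_comm, param]

theorem constantCoeff_eq_zero_of_eq {y : ℂ⟦X⟧} {x : ℂ⸨X⸩} {r : ℕ} (hr : r ≠ 0) (hx : x ∈ regular)
    (h : toLaurent y = param ^ r * x) : PowerSeries.constantCoeff y = 0 := by
  obtain ⟨w, rfl⟩ := hx
  change toLaurent y = param ^ r * toLaurent w at h
  rw [param, ← map_pow, ← map_mul] at h
  rw [toLaurent_injective h]
  simp [hr]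

/-- A linear system that is nondegenerate at `s = 0` has no solutions with poles when its right
hand side has none. -/
theorem regular_of_mulVec_regular {κ ι : Type*} [Fintype ι] (V : Matrix κ ι ℂ⟦X⟧)
    (hV : ∀ c : ι → ℂ, (∀ k, ∑ j, PowerSeries.constantCoeff (V k j) * c j = 0) → c = 0)
    (z : ι → ℂ⸨X⸩) (h : ∀ k, ∑ j, toLaurent (V k j) * z j ∈ regular) (j : ι) :
    z j ∈ regular := by
  -- Descent on the pole order: the constant terms of `s ^ (r + 1) z` are killed by `V(0)`, hence
  -- vanish, and one factor `s` can be removed.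
  have main : ∀ r : ℕ, (∀ j, param ^ r * z j ∈ regular) → ∀ j, z j ∈ regular := by
    intro r
    induction r with
    | zero => intro h j; simpa using h j
    | succ r ih =>
      intro hr
      apply ih
      choose y hy using hr
      change ∀ j, toLaurent (y j) = _ at hy
      have h0 : (fun j => PowerSeries.constantCoeff (y j)) = 0 := by
        apply hV
        intro k
        have := constantCoeff_eq_zero_of_eq (y := ∑ j, V k j * y j) (r := r + 1) (by omega) (h k)
          (by
            rw [map_sum, Finset.mul_sum]
            refine Finset.sum_congr rfl fun j _ => ?_
            rw [map_mul, hy]; ring)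
        simpa using this
      intro j
      obtain ⟨w, hw⟩ := PowerSeries.X_dvd_iff.2 (congrFun h0 j)
      refine ⟨w, ?_⟩
      change toLaurent w = _
      have := hy j
      rw [hw, map_mul, pow_succ', mul_assoc] at this
      exact mul_left_cancel₀ param_ne_zero this
  choose r hr using fun j => exists_param_pow_mul_mem (z j)
  refine main (∑ j, r j) (fun j => ?_) j
  obtain ⟨q, hq⟩ := Nat.exists_eq_add_of_le
    (Finset.single_le_sum (f := r) (fun _ _ => Nat.zero_le _) (Finset.mem_univ j))
  rw [hq, add_comm, pow_add, mul_assoc]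
  exact regular.mul_mem _ _ (pow_mem param_mem _) (hr j)

/-- Multiplication by `s ^ N` reverses the coefficients: `λ ^ i` becomes `s ^ (N - i)`, and only `i
= N` survives at `s = 0`. -/
theorem exists_toLaurent_atInfinity (c : ℂ[X]) {N : ℕ} (hN : c.natDegree ≤ N) :
    ∃ y, toLaurent y = param ^ N * atInfinity c ∧ PowerSeries.constantCoeff y = c.coeff N := by
  refine ⟨∑ i ∈ Finset.range (N + 1), PowerSeries.C (c.coeff i) * PowerSeries.X ^ (N - i), ?_, ?_⟩
  · rw [atInfinity, aeval_eq_sum_range' (Nat.lt_succ_of_le hN), map_sum, Finset.mul_sum]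
    refine Finset.sum_congr rfl fun i hi => ?_
    have : N = (N - i) + i := by rw [Finset.mem_range] at hi; omega
    rw [map_mul, map_pow, ← algebraMap_eq_toLaurent, Algebra.smul_def]
    conv_rhs => rw [this, pow_add]
    rw [show toLaurent PowerSeries.X = param from rfl, mul_left_comm, mul_assoc, ← mul_pow,
      mul_inv_cancel₀ param_ne_zero, one_pow, mul_one]
  · rw [map_sum, Finset.sum_eq_single_of_mem N (by simp)]
    · simp
    · intro i hi hne
      have : N - i ≠ 0 := by rw [Finset.mem_range] at hi; omega
      simp [this]

/-- A polynomial of degree `k` has a pole of order exactly `k` at infinity. -/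
theorem natDegree_eq_zero_of_mem {c : ℂ[X]} (hc : c ≠ 0) {e : ℕ}
    (h : param⁻¹ ^ e * atInfinity c ∈ regular) : c.natDegree + e = 0 := by
  by_contra hne
  obtain ⟨y, hy, hy0⟩ := exists_toLaurent_atInfinity c le_rfl
  have := constantCoeff_eq_zero_of_eq hne h (by
    rw [hy, pow_add, mul_assoc, ← mul_assoc (param ^ e), ← mul_pow,
      mul_inv_cancel₀ param_ne_zero, one_pow, one_mul])
  rw [hy0] at this
  exact hc (leadingCoeff_eq_zero.1 this)

theorem exists_C_of_atInfinity_mem {c : ℂ[X]} (h : atInfinity c ∈ regular) : ∃ a, c = C a := by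
  by_cases hc : c = 0
  · exact ⟨0, by simp [hc]⟩
  · exact ⟨_, eq_C_of_natDegree_eq_zero
      (by simpa using natDegree_eq_zero_of_mem hc (e := 0) (by simpa using h))⟩

theorem atInfinity_injective : Function.Injective atInfinity := by
  rw [injective_iff_map_eq_zero]
  intro c h
  by_contra hc
  -- Zero stays regular after multiplication by `λ`, so `e = 1` is allowed and the degree equation
  -- is absurd.
  have := natDegree_eq_zero_of_mem hc (e := 1) (by simp [h, regular.zero_mem])
  omega

/-! ### The coordinate ring of a smooth affine plane curve -/

section CoordinateRing

variable {f : ℂ[X][Y]}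

theorem exists_eq_C_X_sub_C_mul (q : ℂ[X][Y]) (a : ℂ) :
    ∃ g : ℂ[X][Y], q = (q.map (evalRingHom a)).map C + C (X - C a) * g := by
  induction q using Polynomial.induction_on' with
  | add p q hp hq =>
    obtain ⟨g, hg⟩ := hp
    obtain ⟨h, hh⟩ := hq
    refine ⟨g + h, ?_⟩
    rw [Polynomial.map_add, Polynomial.map_add, mul_add]
    linear_combination hg + hh
  | monomial k c =>
    obtain ⟨e, he⟩ := X_sub_C_dvd_sub_C_eval (a := a) (p := c)
    refine ⟨monomial k e, ?_⟩
    rw [map_monomial, map_monomial, C_mul_monomial, ← he, ← map_add]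
    simp

/-- A decomposition `f = (λ - a) g + (μ - b) h(μ)` at a point `(a, b)` of the curve `f = 0`. -/
theorem exists_eq_add_of_mem_zeroSet {a b : ℂ} (h : (a, b) ∈ zeroSet f) :
    ∃ (g : ℂ[X][Y]) (k : ℂ[X]), f = C (X - C a) * g + (Y - C (C b)) * k.map C ∧
      g.evalEval a b = partialFst f (a, b) ∧ k.eval b = partialSnd f (a, b) := by
  obtain ⟨g, hg⟩ := exists_eq_C_X_sub_C_mul f a
  have hroot : (f.map (evalRingHom a)).IsRoot b := by
    have : f.evalEval a b = 0 := h
    rwa [← map_evalRingHom_eval] at this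
  obtain ⟨k, hk⟩ := dvd_iff_isRoot.2 hroot
  have hf : f = C (X - C a) * g + (Y - C (C b)) * k.map C := by
    conv_lhs => rw [hg, hk]
    rw [Polynomial.map_mul, Polynomial.map_sub, map_X, map_C]
    ring
  refine ⟨g, k, hf, ?_, ?_⟩
  · have : f.eval (C b) = (X - C a) * g.eval (C b) := by
      conv_lhs => rw [hf]
      simp
    rw [partialFst]
    simp only [this, derivative_mul, evalEval]
    simp
  · rw [partialSnd]
    conv_rhs => rw [hf]
    simp [evalEval]

/-- Nullstellensatz: the residue field is finite over `ℂ`, hence equal to it. -/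
theorem exists_algHom_of_isMaximal (𝔭 : Ideal (AdjoinRoot f)) [𝔭.IsMaximal] :
    ∃ χ : AdjoinRoot f →ₐ[ℂ] ℂ, ∀ x, χ x = 0 ↔ x ∈ 𝔭 := by
  let : Field (AdjoinRoot f ⧸ 𝔭) := Ideal.Quotient.field 𝔭
  have : Module.Finite ℂ (AdjoinRoot f ⧸ 𝔭) := finite_of_finite_type_of_isJacobsonRing _ _
  let e : ℂ ≃ₐ[ℂ] (AdjoinRoot f ⧸ 𝔭) := AlgEquiv.ofBijective (Algebra.ofId _ _)
    (IsAlgClosed.algebraMap_bijective_of_isIntegral)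
  refine ⟨(e.symm : _ →ₐ[ℂ] ℂ).comp (Ideal.Quotient.mkₐ ℂ 𝔭), fun x => ?_⟩
  simp [Ideal.Quotient.eq_zero_iff_mem]

theorem algHom_mk_eq_evalEval (χ : AdjoinRoot f →ₐ[ℂ] ℂ) (q : ℂ[X][Y]) :
    χ (AdjoinRoot.mk f q) = q.evalEval (χ (AdjoinRoot.of f X)) (χ (AdjoinRoot.root f)) := by
  have h : (χ : AdjoinRoot f →+* ℂ).comp (AdjoinRoot.mk f) =
      evalEvalRingHom (χ (AdjoinRoot.of f X)) (χ (AdjoinRoot.root f)) := by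
    apply Polynomial.ringHom_ext'
    · apply Polynomial.ringHom_ext'
      · refine RingHom.ext fun c => ?_
        have := χ.commutes c
        rw [AdjoinRoot.algebraMap_eq'] at this
        simpa using this
      · simp
    · simp
  exact congrArg (fun φ => φ q) h

theorem mem_zeroSet_of_algHom (χ : AdjoinRoot f →ₐ[ℂ] ℂ) :
    (χ (AdjoinRoot.of f X), χ (AdjoinRoot.root f)) ∈ zeroSet f := by
  have := algHom_mk_eq_evalEval χ f
  rw [AdjoinRoot.mk_self, map_zero] at this
  exact this.symm

theorem ker_algHom_le_span (χ : AdjoinRoot f →ₐ[ℂ] ℂ) (x : AdjoinRoot f) (hx : χ x = 0) :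
    x ∈ Ideal.span {AdjoinRoot.of f (X - C (χ (AdjoinRoot.of f X))),
      AdjoinRoot.root f - AdjoinRoot.of f (C (χ (AdjoinRoot.root f)))} := by
  obtain ⟨q, rfl⟩ := AdjoinRoot.mk_surjective x
  rw [algHom_mk_eq_evalEval] at hx
  obtain ⟨g, k, h, -, -⟩ := exists_eq_add_of_mem_zeroSet (f := q) hx
  rw [h, map_add, map_mul, map_mul, map_sub _ (Y : ℂ[X][Y]), AdjoinRoot.mk_C, AdjoinRoot.mk_C,
    AdjoinRoot.mk_X]
  exact Ideal.add_mem _ (Ideal.mul_mem_right _ _ (Ideal.subset_span (by simp)))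
    (Ideal.mul_mem_right _ _ (Ideal.subset_span (by simp)))

/-- Jacobian criterion. At a point `(a, b)` the equation reads `(λ - a) g + (μ - b) k = 0` with `g`,
`k` taking the values of the partial derivatives there. One of them is a unit in the local ring, so
one of the two generators of the maximal ideal divides the other, and a Noetherian local domain with
principal nonzero maximal ideal is a DVR. -/
theorem isDedekindDomain_adjoinRoot (hm : f.Monic) [IsDomain (AdjoinRoot f)]
    (hs : singularSet f = ∅) : IsDedekindDomain (AdjoinRoot f) := by
  have := hm.finite_adjoinRoot
  suffices IsDedekindDomainDvr (AdjoinRoot f) from inferInstance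
  refine { toIsNoetherian := (inferInstance : IsNoetherianRing (AdjoinRoot f)), 
           is_dvr_at_nonzero_prime := fun 𝔭 h0 hp => ?_ }
  have hmax : 𝔭.IsMaximal := by
    apply Ideal.isMaximal_of_isIntegral_of_isMaximal_comap (R := ℂ[X])
    refine IsPrime.to_maximal_ideal (hpi := Ideal.IsPrime.comap _) fun h => h0 ?_
    exact Ideal.eq_bot_of_comap_eq_bot h
  obtain ⟨χ, hχ⟩ := exists_algHom_of_isMaximal 𝔭
  set a := χ (AdjoinRoot.of f X) with ha
  set b := χ (AdjoinRoot.root f) with hb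
  obtain ⟨g, k, hf, hg, hk⟩ := exists_eq_add_of_mem_zeroSet (mem_zeroSet_of_algHom χ)
  set x := AdjoinRoot.of f (X - C a) with hx
  set y := AdjoinRoot.root f - AdjoinRoot.of f (C b) with hy
  have hrel : x * AdjoinRoot.mk f g + y * AdjoinRoot.mk f (k.map C) = 0 := by
    have := congrArg (AdjoinRoot.mk f) hf
    rw [AdjoinRoot.mk_self, map_add, map_mul, map_mul, map_sub _ (Y : ℂ[X][Y]), AdjoinRoot.mk_C,
      AdjoinRoot.mk_C, AdjoinRoot.mk_X] at this
    exact this.symm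
  have hspan : 𝔭 = Ideal.span {x, y} := by
    apply le_antisymm
    · exact fun z hz => ker_algHom_le_span χ z ((hχ z).2 hz)
    · rw [Ideal.span_le]
      rintro z (rfl | rfl)
      · refine (hχ _).1 ?_
        rw [hx, ← AdjoinRoot.mk_C, algHom_mk_eq_evalEval]
        simp [evalEval, ha]
      · refine (hχ _).1 ?_
        rw [hy, ← AdjoinRoot.mk_C, ← AdjoinRoot.mk_X, ← map_sub, algHom_mk_eq_evalEval]
        simp [evalEval, hb]
  have hcases : AdjoinRoot.mk f g ∉ 𝔭 ∨ AdjoinRoot.mk f (k.map C) ∉ 𝔭 := by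
    by_contra! h
    have : (a, b) ∈ singularSet f := by
      refine ⟨mem_zeroSet_of_algHom χ, ?_, ?_⟩
      · rw [← hg, ← algHom_mk_eq_evalEval]
        exact (hχ _).2 h.1
      · rw [← hk]
        have := (hχ _).2 h.2
        rw [algHom_mk_eq_evalEval] at this
        simpa [evalEval, ← hb] using this
    simp [hs] at this
  let ψ := algebraMap (AdjoinRoot f) (Localization.AtPrime 𝔭)
  have hmap : IsLocalRing.maximalIdeal (Localization.AtPrime 𝔭) = Ideal.span {ψ x, ψ y} := by
    rw [← Localization.AtPrime.map_eq_maximalIdeal, ← Set.image_pair, ← Ideal.map_span,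
      ← hspan]
  have hrel' : ψ x * ψ (AdjoinRoot.mk f g) + ψ y * ψ (AdjoinRoot.mk f (k.map C)) = 0 := by
    rw [← map_mul, ← map_mul, ← map_add, hrel, map_zero]
  have hprin : (IsLocalRing.maximalIdeal (Localization.AtPrime 𝔭)).IsPrincipal := by
    rw [hmap]
    rcases hcases with h | h
    · obtain ⟨u, hu⟩ := IsLocalization.map_units (Localization.AtPrime 𝔭)
        (⟨_, h⟩ : 𝔭.primeCompl)
      refine ⟨ψ y, ?_⟩
      rw [Ideal.submodule_span_eq, Ideal.span_pair_eq_span_right_iff_dvd.2]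
      refine ⟨-ψ (AdjoinRoot.mk f (k.map C)) * ↑u⁻¹, ?_⟩
      rw [← mul_assoc, Units.eq_mul_inv_iff_mul_eq, hu]
      linear_combination hrel'
    · obtain ⟨u, hu⟩ := IsLocalization.map_units (Localization.AtPrime 𝔭)
        (⟨_, h⟩ : 𝔭.primeCompl)
      refine ⟨ψ x, ?_⟩
      rw [Ideal.submodule_span_eq, Ideal.span_pair_eq_span_left_iff_dvd.2]
      refine ⟨-ψ (AdjoinRoot.mk f g) * ↑u⁻¹, ?_⟩
      rw [← mul_assoc, Units.eq_mul_inv_iff_mul_eq, hu]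
      linear_combination hrel'
  have : IsNoetherianRing (Localization.AtPrime 𝔭) :=
    IsLocalization.isNoetherianRing 𝔭.primeCompl _ inferInstance
  exact ((IsDiscreteValuationRing.TFAE (Localization.AtPrime 𝔭)
    (IsLocalization.AtPrime.not_isField _ h0 _)).out 0 4).2 hprin

end CoordinateRing

/-! ### Functions with a single simple pole on a curve of genus zero -/

/-- If only constants belonged to `L(v)`, its dimension would be at most `1` and the divisor `v` of
degree `1` would force genus at least `1`. -/
theorem exists_mem_riemannRochSpace_of_genus_eq_zero {F : Type} [Field F] [Algebra ℂ F]
    (h : genus F = 0) (v : Place F) :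
    ∃ t ∈ riemannRochSpace (Finsupp.single v 1 : Divisor F), ∀ c : ℂ, t ≠ algebraMap ℂ F c := by
  by_contra! hcon
  have hle : riemannRochSpace (Finsupp.single v 1 : Divisor F) ≤ ℂ ∙ (1 : F) := by
    intro t ht
    obtain ⟨c, rfl⟩ := hcon t ht
    exact Submodule.mem_span_singleton.2 ⟨c, (Algebra.algebraMap_eq_smul_one c).symm⟩
  have hfin := (Submodule.finrank_mono hle).trans_eq (finrank_span_singleton one_ne_zero)
  have hD := (iSup_eq_bot.1 (h : _ = ⊥)) (Finsupp.single v 1 : Divisor F)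
  have hdeg : Divisor.degree (Finsupp.single v 1 : Divisor F) = 1 := by
    rw [Divisor.degree, Finsupp.sum_single_index rfl]
  rw [hdeg] at hD
  have hD' : (1 + 1 - (Module.finrank ℂ
      (riemannRochSpace (Finsupp.single v 1 : Divisor F)) : ℤ)).toNat = 0 := by
    exact Nat.cast_eq_zero.1 (hD : _ = (0 : ℕ∞))
  omega

/-- The place of a field defined by an embedding into Laurent series. -/
def placeOfHom {F : Type} [Field F] [Algebra ℂ F] (φ : F →ₐ[ℂ] ℂ⸨X⸩) (π : F) (hπ : φ π = param) :
    Place F :=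
  ⟨regular.comap (φ : F →+* ℂ⸨X⸩), fun c => by
    rw [ValuationSubring.mem_comap]
    have := φ.commutes c
    simp only [RingHom.coe_coe, this]
    exact algebraMap_mem_regular c, fun h => by
    have : π⁻¹ ∈ regular.comap (φ : F →+* ℂ⸨X⸩) := h ▸ ValuationSubring.mem_top _
    rw [ValuationSubring.mem_comap] at this
    simp only [RingHom.coe_coe, map_inv₀, hπ] at this
    rw [← atInfinity_X] at this
    simpa using natDegree_eq_zero_of_mem X_ne_zero (e := 0) (by simpa using this)⟩

theorem mem_placeOfHom {F : Type} [Field F] [Algebra ℂ F] {φ : F →ₐ[ℂ] ℂ⸨X⸩} {π : F}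
    {hπ : φ π = param} {x : F} : x ∈ (placeOfHom φ π hπ).1 ↔ φ x ∈ regular := Iff.rfl

/-- An element whose expansion is a unit power series is a unit of the valuation ring, so
irreducibility of `s` in `ℂ⟦X⟧` passes to its preimage. -/
theorem irreducible_placeOfHom {F : Type} [Field F] [Algebra ℂ F] (φ : F →ₐ[ℂ] ℂ⸨X⸩) (π : F)
    (hπ : φ π = param) :
    Irreducible (⟨π, mem_placeOfHom.2 (hπ ▸ param_mem)⟩ : (placeOfHom φ π hπ).1) := by
  have unit_of : ∀ (u : (placeOfHom φ π hπ).1) (y : ℂ⟦X⟧), toLaurent y = φ u → IsUnit y →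
      IsUnit u := by
    rintro u y hy ⟨w, rfl⟩
    have hne : (u : F) ≠ 0 := by
      intro h0
      rw [h0, map_zero, map_eq_zero_iff _ toLaurent_injective] at hy
      exact w.ne_zero hy
    have hinv : (u : F)⁻¹ ∈ (placeOfHom φ π hπ).1 := by
      rw [mem_placeOfHom, map_inv₀, ← hy]
      refine ⟨↑w⁻¹, ?_⟩
      change toLaurent _ = _
      refine eq_inv_of_mul_eq_one_left ?_
      rw [← map_mul, Units.inv_mul, map_one]
    exact IsUnit.of_mul_eq_one ⟨_, hinv⟩ (Subtype.ext (mul_inv_cancel₀ hne))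
  refine ⟨fun hu => ?_, fun a b hab => ?_⟩
  · obtain ⟨b, hb⟩ := hu.exists_right_inv
    obtain ⟨y, hy⟩ := mem_placeOfHom.1 b.2
    change toLaurent y = _ at hy
    have h1 := congrArg (fun z : (placeOfHom φ π hπ).1 => φ (z : F)) hb
    simp only [MulMemClass.coe_mul, map_mul, hπ, ← hy, OneMemClass.coe_one, map_one] at h1
    rw [param, ← map_mul, ← map_one toLaurent] at h1
    exact PowerSeries.X_irreducible.not_isUnit (IsUnit.of_mul_eq_one _ (toLaurent_injective h1))
  · obtain ⟨y, hy⟩ := mem_placeOfHom.1 a.2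
    obtain ⟨z, hz⟩ := mem_placeOfHom.1 b.2
    have h1 := congrArg (fun z : (placeOfHom φ π hπ).1 => φ (z : F)) hab
    change toLaurent y = _ at hy
    change toLaurent z = _ at hz
    simp only [MulMemClass.coe_mul, map_mul, hπ, ← hy, ← hz] at h1
    rw [param, ← map_mul] at h1
    rcases PowerSeries.X_irreducible.isUnit_or_isUnit (toLaurent_injective h1) with h | h
    · exact Or.inl (unit_of a y hy h)
    · exact Or.inr (unit_of b z hz h)

section FinitePlaces

open IsDedekindDomain WithZero

variable {A F : Type} [CommRing A] [IsDedekindDomain A] [Algebra ℂ A] [Field F] [Algebra ℂ F]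
  [Algebra A F] [IsFractionRing A F] [IsScalarTower ℂ A F]

/-- The place of a maximal ideal of a Dedekind domain. -/
def placeOfIdeal (F : Type) [Field F] [Algebra ℂ F]
    [Algebra A F] [IsFractionRing A F] [IsScalarTower ℂ A F] (v : HeightOneSpectrum A) :
    Place F :=
  ⟨(v.valuation F).valuationSubring, fun c => by
    rw [Valuation.mem_valuationSubring_iff, IsScalarTower.algebraMap_apply ℂ A F]
    exact v.valuation_le_one _, fun h => by
    obtain ⟨π, hπ⟩ := v.valuation_exists_uniformizer F
    have : π⁻¹ ∈ (v.valuation F).valuationSubring := h ▸ ValuationSubring.mem_top _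
    rw [Valuation.mem_valuationSubring_iff, map_inv₀, hπ, ← exp_neg, ← exp_zero,
      exp_le_exp] at this
    omega⟩

theorem mem_placeOfIdeal {v : HeightOneSpectrum A} {x : F} :
    x ∈ (placeOfIdeal F v).1 ↔ v.valuation F x ≤ 1 := Iff.rfl

/-- The Riemann-Roch condition at a place quantifies over local parameters, so it carries
information only when one exists. -/
theorem exists_irreducible_placeOfIdeal (v : HeightOneSpectrum A) :
    ∃ t : (placeOfIdeal F v).1, Irreducible t := by
  obtain ⟨π, hπ⟩ := v.valuation_exists_uniformizer F
  have hmem : π ∈ (placeOfIdeal F v).1 := by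
    rw [mem_placeOfIdeal, hπ, ← exp_zero, exp_le_exp]; omega
  have unit_of : ∀ u : (placeOfIdeal F v).1, v.valuation F u = 1 → IsUnit u := by
    intro u hu
    have hne : (u : F) ≠ 0 := by
      intro h; rw [h, map_zero] at hu; exact zero_ne_one hu
    have hinv : (u : F)⁻¹ ∈ (placeOfIdeal F v).1 := by
      rw [mem_placeOfIdeal, map_inv₀, hu, inv_one]
    exact IsUnit.of_mul_eq_one ⟨_, hinv⟩ (Subtype.ext (mul_inv_cancel₀ hne))
  refine ⟨⟨π, hmem⟩, fun hu => ?_, fun a b hab => ?_⟩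
  · obtain ⟨b, hb⟩ := hu.exists_right_inv
    have h1 := congrArg (fun z : (placeOfIdeal F v).1 => v.valuation F (z : F)) hb
    have h2 := mem_placeOfIdeal.1 b.2
    simp only [MulMemClass.coe_mul, map_mul, OneMemClass.coe_one, map_one, hπ] at h1
    have : (1 : ℤᵐ⁰) ≤ exp (-1) * 1 := h1.symm.trans_le (mul_le_mul_right h2 _)
    rw [mul_one, ← exp_zero, exp_le_exp] at this
    omega
  · have h1 := congrArg (fun z : (placeOfIdeal F v).1 => v.valuation F (z : F)) hab
    have ha := mem_placeOfIdeal.1 a.2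
    have hb := mem_placeOfIdeal.1 b.2
    simp only [MulMemClass.coe_mul, map_mul, hπ] at h1
    have ha0 : v.valuation F (a : F) ≠ 0 := fun h => by simp [h] at h1
    have hb0 : v.valuation F (b : F) ≠ 0 := fun h => by simp [h] at h1
    rw [← exp_log ha0, ← exp_zero, exp_le_exp] at ha
    rw [← exp_log hb0, ← exp_zero, exp_le_exp] at hb
    rw [← exp_log ha0, ← exp_log hb0, ← exp_add, exp_inj] at h1
    have : log (v.valuation F (a : F)) = 0 ∨ log (v.valuation F (b : F)) = 0 := by omega
    rcases this with h | h
    · refine Or.inl (unit_of a ?_)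
      rw [← exp_log ha0, h, exp_zero]
    · refine Or.inr (unit_of b ?_)
      rw [← exp_log hb0, h, exp_zero]

end FinitePlaces

/-! ### Branches at infinity -/

/-- A branch `μ = λ ^ m ν(1 / λ)` at infinity of the curve `f = 0`. -/
structure Branch (f : ℂ[X][Y]) (m : ℕ) where
  /-- The normalized eigenvalue. -/
  nu : ℂ⟦X⟧
  isRoot : f.eval₂ (atInfinity : ℂ[X] →+* ℂ⸨X⸩) (param⁻¹ ^ m * toLaurent nu) = 0

namespace Branch

variable {f : ℂ[X][Y]} {m : ℕ} (b : Branch f m)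

/-- The value of `μ / λ ^ m` at the point at infinity of the branch. -/
def value : ℂ := PowerSeries.constantCoeff b.nu

/-- The expansion of regular functions on the curve along the branch. -/
def hom : AdjoinRoot f →ₐ[ℂ] ℂ⸨X⸩ := AdjoinRoot.liftAlgHom f atInfinity _ b.isRoot

@[simp]
theorem hom_of (c : ℂ[X]) : b.hom (AdjoinRoot.of f c) = atInfinity c :=
  AdjoinRoot.liftAlgHom_of ..

@[simp]
theorem hom_root : b.hom (AdjoinRoot.root f) = param⁻¹ ^ m * toLaurent b.nu :=
  AdjoinRoot.liftAlgHom_root ..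

theorem hom_mk (q : ℂ[X][Y]) : b.hom (AdjoinRoot.mk f q) =
    q.eval₂ (atInfinity : ℂ[X] →+* ℂ⸨X⸩) (param⁻¹ ^ m * toLaurent b.nu) :=
  AdjoinRoot.liftAlgHom_mk ..

/-- The ring is an integral extension of `ℂ[X]`, so a nonzero kernel would meet `ℂ[X]`, where
expansion at infinity is injective. -/
theorem hom_injective (hm : f.Monic) [IsDomain (AdjoinRoot f)] : Function.Injective b.hom := by
  have := hm.finite_adjoinRoot
  have hker : RingHom.ker b.hom = ⊥ := by
    apply Ideal.eq_bot_of_comap_eq_bot (R := ℂ[X])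
    rw [eq_bot_iff]
    intro c hc
    rw [Ideal.mem_comap, AdjoinRoot.algebraMap_eq, RingHom.mem_ker, hom_of] at hc
    exact atInfinity_injective (hc.trans (map_zero _).symm)
  exact (RingHom.injective_iff_ker_eq_bot b.hom).2 hker

end Branch

section Uniformization

variable {f : ℂ[X][Y]} {m : ℕ} {κ : Type} {br : κ → Branch f m}

/-- A regular function without poles at infinity is constant. -/
theorem exists_algebraMap_of_forall_mem_regular [Fintype κ] (hf : f.Monic) (hm : m ≠ 0)
    (hinj : Function.Injective fun k => (br k).value) (hcard : Fintype.card κ = f.natDegree)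
    (x : AdjoinRoot f) (hx : ∀ k, (br k).hom x ∈ regular) :
    ∃ c : ℂ, x = algebraMap ℂ (AdjoinRoot f) c := by
  set p := AdjoinRoot.modByMonicHom hf x with hp
  have hxp : x = AdjoinRoot.mk f p := (AdjoinRoot.mk_leftInverse hf x).symm
  have hdeg : p.degree < f.natDegree := by
    obtain ⟨q, rfl⟩ := AdjoinRoot.mk_surjective x
    rw [hp, AdjoinRoot.modByMonicHom_mk, ← degree_eq_natDegree hf.ne_zero]
    exact degree_modByMonic_lt q hf
  rcases Nat.eq_zero_or_pos f.natDegree with h0 | h0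
  · rw [h0, Nat.cast_zero, Nat.WithBot.lt_zero_iff, degree_eq_bot] at hdeg
    exact ⟨0, by rw [hxp, hdeg, map_zero, map_zero]⟩
  have hnat : p.natDegree < f.natDegree := by
    by_cases hp0 : p = 0
    · simpa [hp0] using h0
    · exact (natDegree_lt_iff_degree_lt hp0).2 hdeg
  -- Write `x = ∑ p_i(λ) μ ^ i` with `i < deg f`. Along the branch `k` this is `∑ (λ ^ (m i) p_i)
  -- ν_k ^ i`, a system with Vandermonde matrix that is nondegenerate at `s = 0` because the values
  -- are distinct. So every `λ ^ (m i) p_i` is regular, which leaves only a constant `p_0`.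
  have hz := regular_of_mulVec_regular
    (Matrix.of fun (k : κ) (i : Fin f.natDegree) => (br k).nu ^ (i : ℕ)) ?_
    (fun i => param⁻¹ ^ (m * i) * atInfinity (p.coeff i)) ?_
  · have hc : ∀ i, p.coeff i ≠ 0 → (p.coeff i).natDegree + m * i = 0 := by
      intro i hi
      have : i < f.natDegree := by
        by_contra! h
        exact hi (coeff_eq_zero_of_degree_lt (hdeg.trans_le (by exact_mod_cast h)))
      exact natDegree_eq_zero_of_mem hi (hz ⟨i, this⟩)
    have hp0 : p = C (p.coeff 0) := by
      ext1 i
      rw [coeff_C]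
      split_ifs with h
      · rw [h]
      · by_contra hne
        have := hc i hne
        have h2 : m * i ≠ 0 := Nat.mul_ne_zero hm h
        omega
    have hp1 : (p.coeff 0).natDegree = 0 := by
      by_cases h : p.coeff 0 = 0
      · simp [h]
      · have := hc 0 h; omega
    rw [eq_C_of_natDegree_eq_zero hp1] at hp0
    refine ⟨(p.coeff 0).coeff 0, ?_⟩
    rw [hxp, hp0, AdjoinRoot.mk_C, AdjoinRoot.algebraMap_eq']
    simp
  · intro c hc
    let q : ℂ[X] := ∑ i : Fin f.natDegree, C (c i) * X ^ (i : ℕ)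
    have hq : q = 0 := by
      apply eq_zero_of_natDegree_lt_card_of_eval_eq_zero q hinj
      · intro k
        have := hc k
        simp only [q, eval_finsetSum, eval_mul, eval_C, eval_pow, eval_X, Branch.value]
        rw [← this]
        refine Finset.sum_congr rfl fun i _ => ?_
        simp [mul_comm]
      · rw [hcard]
        refine (natDegree_sum_le_of_forall_le (n := f.natDegree - 1) _ _ fun i _ => ?_).trans_lt
          (by omega)
        exact (natDegree_C_mul_X_pow_le _ _).trans (by omega)
    funext i
    have := congrArg (fun q => q.coeff i) hq
    simpa [q, finsetSum_coeff, coeff_X_pow, Fin.val_inj] using this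
  · intro k
    have := hx k
    rw [hxp, Branch.hom_mk, eval₂_eq_sum_range' _
      hnat, ← Fin.sum_univ_eq_sum_range
      (fun i => (atInfinity : ℂ[X] →+* ℂ⸨X⸩) (p.coeff i) *
        (param⁻¹ ^ m * toLaurent (br k).nu) ^ i)] at this
    convert! this using 2 with i
    simp only [Matrix.of_apply, map_pow, RingHom.coe_coe, mul_pow, pow_mul]
    ring

/-- A nonconstant element of `L(v)`, with `v` the place of the branch `k₀`, is regular at all finite
places, hence lies in the coordinate ring, which is Dedekind. -/
theorem exists_simple_pole (hf : f.Monic) [IsDomain (AdjoinRoot f)] (hs : singularSet f = ∅)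
    (hg : genus (FractionRing (AdjoinRoot f)) = 0)
    (hinj : Function.Injective fun k => (br k).value) (k₀ : κ) :
    ∃ t : AdjoinRoot f, (∀ c : ℂ, t ≠ algebraMap ℂ (AdjoinRoot f) c) ∧
      param * (br k₀).hom t ∈ regular ∧ ∀ k, k ≠ k₀ → (br k).hom t ∈ regular := by
  have := isDedekindDomain_adjoinRoot hf hs
  let F := FractionRing (AdjoinRoot f)
  let ψ : κ → F →ₐ[ℂ] ℂ⸨X⸩ := fun k => IsFractionRing.liftAlgHom ((br k).hom_injective hf)
  have hψ : ∀ k x, ψ k (algebraMap (AdjoinRoot f) F x) = (br k).hom x := fun k x =>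
    IsFractionRing.lift_algebraMap ((br k).hom_injective hf) x
  let lam : F := algebraMap (AdjoinRoot f) F (AdjoinRoot.of f X)
  have hlam : ∀ k, ψ k lam⁻¹ = param := fun k => by
    rw [map_inv₀, hψ, Branch.hom_of, atInfinity_X, inv_inv]
  let v : κ → Place F := fun k => placeOfHom (ψ k) lam⁻¹ (hlam k)
  -- The function `μ / λ ^ m - value(k₀)` separates the two places: it vanishes at `k₀` and is a
  -- unit at `k`.
  have hv : ∀ k, k ≠ k₀ → v k ≠ v k₀ := by
    intro k hk h
    have hsub : ∀ x : F, ψ k x ∈ regular ↔ ψ k₀ x ∈ regular := fun x => by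
      have h2 : x ∈ (v k).1 ↔ x ∈ (v k₀).1 := by rw [h]
      exact h2
    let x : F := lam⁻¹ ^ m * algebraMap (AdjoinRoot f) F (AdjoinRoot.root f) -
      algebraMap ℂ F (br k₀).value
    have hx : ∀ j, ψ j x = toLaurent ((br j).nu - PowerSeries.C (br k₀).value) := fun j => by
      rw [map_sub, map_mul, map_pow, hlam, hψ, Branch.hom_root, AlgHom.commutes, map_sub,
        algebraMap_eq_toLaurent, ← mul_assoc, ← mul_pow, mul_inv_cancel₀ param_ne_zero, one_pow,
        one_mul]
    have hunit : IsUnit ((br k).nu - PowerSeries.C (br k₀).value) := by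
      rw [PowerSeries.isUnit_iff_constantCoeff, map_sub, PowerSeries.constantCoeff_C,
        isUnit_iff_ne_zero, sub_ne_zero]
      exact fun h => hk (hinj h)
    have h1 : ψ k x⁻¹ ∈ regular := by
      obtain ⟨w, hw⟩ := hunit
      refine ⟨↑w⁻¹, ?_⟩
      change toLaurent _ = _
      rw [map_inv₀, hx]
      refine eq_inv_of_mul_eq_one_left ?_
      rw [← hw, ← map_mul, Units.inv_mul, map_one]
    have hx0 : ψ k₀ x ≠ 0 := by
      intro h0
      rw [map_eq_zero] at h0
      have := hx k
      rw [h0, map_zero, eq_comm, map_eq_zero_iff _ toLaurent_injective] at this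
      exact hunit.ne_zero this
    obtain ⟨w, hw⟩ := (hsub _).1 h1
    change toLaurent w = _ at hw
    have h2 : toLaurent (w * ((br k₀).nu - PowerSeries.C (br k₀).value)) = toLaurent 1 := by
      rw [map_mul, hw, ← hx, map_inv₀, inv_mul_cancel₀ hx0, map_one]
    have h3 := congrArg PowerSeries.constantCoeff (toLaurent_injective h2)
    simp [Branch.value] at h3
  obtain ⟨t, ht, htc⟩ := exists_mem_riemannRochSpace_of_genus_eq_zero hg (v k₀)
  have ht' : ∀ (w : Place F) (π : w.1), Irreducible π →
    (π : F) ^ ((Finsupp.single (v k₀) 1 : Divisor F) w) * t ∈ w.1 := ht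
  obtain ⟨x, rfl⟩ := IsDedekindDomain.HeightOneSpectrum.mem_integers_of_valuation_le_one
    (R := AdjoinRoot f) F t fun w => by
      obtain ⟨π, hπ⟩ := exists_irreducible_placeOfIdeal (F := F) w
      have := ht' _ π hπ
      rw [Finsupp.single_eq_of_ne, zpow_zero, one_mul] at this
      · exact mem_placeOfIdeal.1 this
      -- A finite place is not the place of `k₀`: `λ` is regular at the former and has a pole at the
      -- latter.
      · intro h
        have h1 : lam ∈ (placeOfIdeal F w).1 := mem_placeOfIdeal.2 (w.valuation_le_one _)
        rw [h] at h1
        have h2 := mem_placeOfHom.1 h1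
        rw [hψ, Branch.hom_of] at h2
        simpa using natDegree_eq_zero_of_mem X_ne_zero (e := 0) (by simpa using h2)
  refine ⟨x, fun c hc => htc c ?_, ?_, fun k hk => ?_⟩
  · rw [hc, ← IsScalarTower.algebraMap_apply]
  · have := ht' _ _ (irreducible_placeOfHom (ψ k₀) lam⁻¹ (hlam k₀))
    rw [Finsupp.single_eq_same, zpow_one, mem_placeOfHom, map_mul, hψ] at this
    simpa only [hlam] using this
  · have := ht' _ _ (irreducible_placeOfHom (ψ k) lam⁻¹ (hlam k))
    rw [Finsupp.single_eq_of_ne (hv k hk), zpow_zero, one_mul, mem_placeOfHom, hψ] at this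
    exact this

end Uniformization

/-- A regular function on `f = 0` with a simple pole at the branch `k₀` and no pole at the other
branches. -/
structure Coordinate {f : ℂ[X][Y]} {m : ℕ} {κ : Type} (br : κ → Branch f m) (k₀ : κ) where
  /-- The function. -/
  t : AdjoinRoot f
  /-- The expansion of `t / λ` at `k₀`. -/
  lead : ℂ⟦X⟧
  lead_ne_zero : PowerSeries.constantCoeff lead ≠ 0
  toLaurent_lead : toLaurent lead = param * (br k₀).hom t
  /-- The expansions of `t` at the other branches. -/
  expansion : κ → ℂ⟦X⟧
  toLaurent_expansion : ∀ k, k ≠ k₀ → toLaurent (expansion k) = (br k).hom t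

section

variable {f : ℂ[X][Y]} {m : ℕ} {κ : Type} {br : κ → Branch f m} {k₀ : κ}

theorem nonempty_coordinate [Fintype κ] (hf : f.Monic) [IsDomain (AdjoinRoot f)] (hm : m ≠ 0)
    (hs : singularSet f = ∅) (hg : genus (FractionRing (AdjoinRoot f)) = 0)
    (hinj : Function.Injective fun k => (br k).value) (hcard : Fintype.card κ = f.natDegree) :
    Nonempty (Coordinate br k₀) := by
  classical
  obtain ⟨t, hc, ⟨y, hy⟩, hreg⟩ := exists_simple_pole hf hs hg hinj k₀
  change toLaurent y = _ at hy
  choose w hw using hreg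
  refine ⟨⟨t, y, fun h0 => ?_, hy, fun k => if h : k ≠ k₀ then w k h else 0, fun k hk => ?_⟩⟩
  · obtain ⟨c, hc'⟩ := exists_algebraMap_of_forall_mem_regular (br := br) hf hm hinj hcard t
      fun k => by
        by_cases hk : k = k₀
        · subst hk
          obtain ⟨z, rfl⟩ := PowerSeries.X_dvd_iff.2 h0
          rw [map_mul] at hy
          exact ⟨z, mul_left_cancel₀ param_ne_zero hy⟩
        · exact ⟨w k hk, hw k hk⟩
    exact hc c hc'
  · simp only [dif_pos hk]
    exact hw k hk

namespace Coordinate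

variable (T : Coordinate br k₀)

theorem exists_toLaurent_pole (g : ℂ[X]) {N : ℕ} (hN : g.natDegree ≤ N) :
    ∃ y, toLaurent y = param ^ N * (br k₀).hom (aeval T.t g) ∧
      PowerSeries.constantCoeff y = g.coeff N * PowerSeries.constantCoeff T.lead ^ N := by
  refine ⟨∑ i ∈ Finset.range (N + 1), PowerSeries.C (g.coeff i) * PowerSeries.X ^ (N - i) *
    T.lead ^ i, ?_, ?_⟩
  · rw [aeval_eq_sum_range' (Nat.lt_succ_of_le hN), map_sum, map_sum, Finset.mul_sum]
    refine Finset.sum_congr rfl fun i hi => ?_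
    have : N = (N - i) + i := by rw [Finset.mem_range] at hi; omega
    rw [map_mul, map_mul, map_pow, map_pow, T.toLaurent_lead, ← algebraMap_eq_toLaurent,
      Algebra.smul_def, map_mul, AlgHom.commutes, map_pow, mul_pow]
    conv_rhs => rw [this, pow_add]
    rw [param]
    ring
  · rw [map_sum, Finset.sum_eq_single_of_mem N (by simp)]
    · simp
    · intro i hi hne
      have : N - i ≠ 0 := by rw [Finset.mem_range] at hi; omega
      simp [this]

theorem exists_toLaurent_regular (g : ℂ[X]) {k : κ} (hk : k ≠ k₀) :
    ∃ y, toLaurent y = (br k).hom (aeval T.t g) ∧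
      PowerSeries.constantCoeff y = g.eval (PowerSeries.constantCoeff (T.expansion k)) := by
  refine ⟨g.eval₂ PowerSeries.C (T.expansion k), ?_, ?_⟩
  · rw [hom_eval₂, ← aeval_algHom_apply, ← T.toLaurent_expansion k hk, aeval_def]
    congr 1
  · rw [hom_eval₂, eval]
    congr 1

theorem aeval_injective : Function.Injective (aeval (R := ℂ) T.t) := by
  rw [injective_iff_map_eq_zero]
  intro g hg
  obtain ⟨y, hy, hy0⟩ := T.exists_toLaurent_pole g le_rfl
  rw [hg, map_zero, mul_zero, map_eq_zero_iff _ toLaurent_injective] at hy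
  rw [hy, map_zero, eq_comm, mul_eq_zero, or_iff_left (pow_ne_zero _ T.lead_ne_zero)] at hy0
  exact leadingCoeff_eq_zero.1 hy0

/-- Subtracting multiples of powers of `t` lowers the pole order at `k₀` until no pole remains, and
then the function is constant. -/
theorem exists_aeval_of_regular [Fintype κ] (hf : f.Monic) (hm : m ≠ 0)
    (hinj : Function.Injective fun k => (br k).value) (hcard : Fintype.card κ = f.natDegree)
    (x : AdjoinRoot f) (hx : ∀ k, k ≠ k₀ → (br k).hom x ∈ regular) :
    ∃ g : ℂ[X], x = aeval T.t g := by
  have key : ∀ (r : ℕ) (x : AdjoinRoot f), (∀ k, k ≠ k₀ → (br k).hom x ∈ regular) →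
      param ^ r * (br k₀).hom x ∈ regular → ∃ g : ℂ[X], x = aeval T.t g := by
    intro r
    induction r with
    | zero =>
      intro x hx h0
      rw [pow_zero, one_mul] at h0
      obtain ⟨c, rfl⟩ := exists_algebraMap_of_forall_mem_regular (br := br) hf hm hinj hcard x
        fun k => by
          by_cases hk : k = k₀
          · rwa [hk]
          · exact hx k hk
      exact ⟨C c, by rw [aeval_C]⟩
    | succ r ih =>
      rintro x hx ⟨w, hw⟩
      change toLaurent w = _ at hw
      set c := PowerSeries.constantCoeff w / PowerSeries.constantCoeff T.lead ^ (r + 1) with hc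
      obtain ⟨y, hy, hy0⟩ := T.exists_toLaurent_pole (C c * X ^ (r + 1)) (N := r + 1)
        (natDegree_C_mul_X_pow_le _ _)
      rw [coeff_C_mul, coeff_X_pow_self, mul_one, hc,
        div_mul_cancel₀ _ (pow_ne_zero _ T.lead_ne_zero)] at hy0
      obtain ⟨g, hg⟩ := ih (x - aeval T.t (C c * X ^ (r + 1))) (fun k hk => by
        obtain ⟨u, hu, -⟩ := T.exists_toLaurent_regular (C c * X ^ (r + 1)) hk
        rw [map_sub, ← hu]
        exact sub_mem (hx k hk) (toLaurent_mem u)) (by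
        obtain ⟨z, hz⟩ := PowerSeries.X_dvd_iff.2
          (show PowerSeries.constantCoeff (w - y) = 0 by rw [map_sub, hy0, sub_self])
        refine ⟨z, mul_left_cancel₀ param_ne_zero ?_⟩
        change param * toLaurent z = _
        rw [param, ← map_mul, ← hz, map_sub, hw, hy, map_sub, pow_succ', param]
        ring)
      exact ⟨g + C c * X ^ (r + 1), by rw [map_add, ← hg, sub_add_cancel]⟩
  obtain ⟨r, hr⟩ := exists_param_pow_mul_mem ((br k₀).hom x)
  exact key r x hx hr

/-- High powers of `t - t(k)` cancel the poles at the branches `k ≠ k₀`; what remains is a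
polynomial in `t`. -/
theorem exists_denominator_aux [Fintype κ] (hf : f.Monic) (hm : m ≠ 0)
    (hinj : Function.Injective fun k => (br k).value) (hcard : Fintype.card κ = f.natDegree)
    (x : AdjoinRoot f) : ∃ (N : ℕ) (s : Finset κ), k₀ ∉ s ∧ ∃ g : ℂ[X],
      aeval T.t (∏ k ∈ s, (X - C (PowerSeries.constantCoeff (T.expansion k))) ^ N) * x =
        aeval T.t g := by
  classical
  choose r hr using fun k => exists_param_pow_mul_mem ((br k).hom x)
  refine ⟨∑ k, r k, Finset.univ.erase k₀, by simp, ?_⟩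
  obtain ⟨g, hg⟩ := T.exists_aeval_of_regular hf hm hinj hcard
    (aeval T.t (∏ k ∈ Finset.univ.erase k₀,
      (X - C (PowerSeries.constantCoeff (T.expansion k))) ^ (∑ k, r k)) * x) fun k hk => by
    rw [← Finset.mul_prod_erase _ _ (Finset.mem_erase.2 ⟨hk, Finset.mem_univ k⟩), map_mul, map_mul,
      map_mul]
    obtain ⟨u, hu, -⟩ := T.exists_toLaurent_regular (∏ k ∈ (Finset.univ.erase k₀).erase k,
      (X - C (PowerSeries.constantCoeff (T.expansion k))) ^ (∑ k, r k)) hk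
    obtain ⟨y, hy, hy0⟩ := T.exists_toLaurent_regular
      (X - C (PowerSeries.constantCoeff (T.expansion k))) hk
    rw [eval_sub, eval_X, eval_C, sub_self] at hy0
    obtain ⟨z, rfl⟩ := PowerSeries.X_dvd_iff.2 hy0
    obtain ⟨q, hq⟩ := Nat.exists_eq_add_of_le
      (Finset.single_le_sum (f := r) (fun _ _ => Nat.zero_le _) (Finset.mem_univ k))
    rw [map_pow, map_pow, ← hy, ← hu, map_mul, mul_pow]
    rw [show toLaurent PowerSeries.X = param from rfl]
    have : param ^ (∑ k, r k) * toLaurent z ^ (∑ k, r k) * toLaurent u * (br k).hom x =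
        (param ^ r k * (br k).hom x) * (param ^ q * toLaurent z ^ (∑ k, r k) * toLaurent u) := by
      conv_lhs => rw [hq, pow_add]
      rw [← hq]
      ring
    rw [this]
    exact mul_mem (hr k) (mul_mem (mul_mem (pow_mem param_mem _) (pow_mem (toLaurent_mem z) _))
      (toLaurent_mem u))
  exact ⟨g, hg⟩

/-- Write `λ = g'(t) / q'(t)` in lowest terms. A Bezout relation `α q' + β g' = 1` gives `q'(t)
(α(t) + β(t) λ) = 1`, so `q'(t)` is a unit. As `λ` has a pole at `k`, `q'` vanishes at `t(k)`, and
`t - t(k)` divides this unit. -/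
theorem isUnit_aeval_X_sub_C [Fintype κ] (hf : f.Monic) [IsDomain (AdjoinRoot f)] (hm : m ≠ 0)
    (hinj : Function.Injective fun k => (br k).value) (hcard : Fintype.card κ = f.natDegree)
    {k : κ} (hk : k ≠ k₀) :
    IsUnit (aeval T.t (X - C (PowerSeries.constantCoeff (T.expansion k)))) := by
  obtain ⟨N, s, -, g, hg⟩ := T.exists_denominator_aux hf hm hinj hcard (AdjoinRoot.of f X)
  set q := ∏ k ∈ s, (X - C (PowerSeries.constantCoeff (T.expansion k))) ^ N with hq
  have hq0 : q ≠ 0 := (monic_prod_of_monic _ _ fun k _ => (monic_X_sub_C _).pow _).ne_zero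
  obtain ⟨d, hd⟩ : ∃ d, d = EuclideanDomain.gcd q g := ⟨_, rfl⟩
  have hd0 : d ≠ 0 := fun h => hq0 (EuclideanDomain.gcd_eq_zero_iff.1 (hd.symm.trans h)).1
  obtain ⟨q', hq'⟩ : d ∣ q := hd ▸ EuclideanDomain.gcd_dvd_left _ _
  obtain ⟨g', hg'⟩ : d ∣ g := hd ▸ EuclideanDomain.gcd_dvd_right _ _
  obtain ⟨α, β, hαβ⟩ : IsCoprime q' g' := by
    have := EuclideanDomain.gcd_eq_gcd_ab q g
    rw [← hd] at this
    refine ⟨EuclideanDomain.gcdA q g, EuclideanDomain.gcdB q g, mul_left_cancel₀ hd0 ?_⟩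
    conv_rhs => rw [mul_one, this]
    conv_rhs => rw [hq', hg']
    conv_lhs => rw [hq', hg']
    ring
  have hrel : aeval T.t q' * AdjoinRoot.of f X = aeval T.t g' := by
    have hd1 : aeval T.t d ≠ 0 := fun h => hd0 (T.aeval_injective (h.trans (map_zero _).symm))
    apply mul_left_cancel₀ hd1
    rw [← mul_assoc, ← map_mul, ← map_mul, ← hq', ← hg', hg]
  have hunit : IsUnit (aeval T.t q') := by
    refine IsUnit.of_mul_eq_one (aeval T.t α + aeval T.t β * AdjoinRoot.of f X) ?_
    have := congrArg (aeval T.t) hαβ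
    rw [map_add, map_mul, map_mul, map_one, ← hrel] at this
    linear_combination this
  have hroot : q'.IsRoot (PowerSeries.constantCoeff (T.expansion k)) := by
    obtain ⟨y, hy, hy0⟩ := T.exists_toLaurent_regular q' hk
    obtain ⟨z, hz, -⟩ := T.exists_toLaurent_regular g' hk
    rw [IsRoot, ← hy0]
    refine constantCoeff_eq_zero_of_eq (r := 1) one_ne_zero (toLaurent_mem z) ?_
    rw [hz, ← hrel, map_mul, ← hy, Branch.hom_of, atInfinity_X, pow_one, mul_comm (toLaurent y),
      mul_inv_cancel_left₀ param_ne_zero]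
  obtain ⟨c, hc⟩ := dvd_iff_isRoot.2 hroot
  rw [hc, map_mul] at hunit
  exact isUnit_of_mul_isUnit_left hunit

theorem exists_denominator [Fintype κ] (hf : f.Monic) [IsDomain (AdjoinRoot f)] (hm : m ≠ 0)
    (hinj : Function.Injective fun k => (br k).value) (hcard : Fintype.card κ = f.natDegree)
    (x : AdjoinRoot f) : ∃ q g : ℂ[X], IsUnit (aeval T.t q) ∧ aeval T.t q * x = aeval T.t g := by
  obtain ⟨N, s, hs, g, hg⟩ := T.exists_denominator_aux hf hm hinj hcard x
  refine ⟨_, g, ?_, hg⟩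
  rw [map_prod]
  refine IsUnit.prod_iff.2 fun k hk => ?_
  rw [map_pow]
  exact (T.isUnit_aeval_X_sub_C hf hm hinj hcard (fun h => hs (h ▸ hk))).pow _

/-- The pole order at the branch `k` of a polynomial of degree `N` in the coordinate. -/
def poleOrder [DecidableEq κ] (_ : Coordinate br k₀) (N : ℕ) (k : κ) : ℕ := if k = k₀ then N else 0

theorem param_pow_mul_mem_regular [DecidableEq κ] (g : ℂ[X]) {N : ℕ} (hN : g.natDegree ≤ N)
    (k : κ) : param ^ T.poleOrder N k * (br k).hom (aeval T.t g) ∈ regular := by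
  unfold poleOrder
  split_ifs with h
  · subst h
    obtain ⟨y, hy, -⟩ := T.exists_toLaurent_pole g hN
    exact ⟨y, hy⟩
  · obtain ⟨y, hy, -⟩ := T.exists_toLaurent_regular g h
    exact ⟨y, hy.trans (by simp)⟩

/-- Coprime polynomials in the coordinate do not vanish simultaneously at any branch. -/
theorem exists_leading_vector [DecidableEq κ] {ι : Type} [Fintype ι] (g : ι → ℂ[X]) {N : ℕ}
    (hN : ∀ j, (g j).natDegree ≤ N) (hmax : ∃ j, (g j).coeff N ≠ 0)
    (hg : ∃ α : ι → ℂ[X], ∑ j, α j * g j = 1) (k : κ) :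
    ∃ y : ι → ℂ⟦X⟧,
      (∀ j, toLaurent (y j) = param ^ T.poleOrder N k * (br k).hom (aeval T.t (g j))) ∧
      ∃ j, PowerSeries.constantCoeff (y j) ≠ 0 := by
  unfold poleOrder
  split_ifs with h
  · subst h
    choose y hy hy0 using fun j => T.exists_toLaurent_pole (g j) (hN j)
    obtain ⟨j, hj⟩ := hmax
    exact ⟨y, hy, j, by rw [hy0]; exact mul_ne_zero hj (pow_ne_zero _ T.lead_ne_zero)⟩
  · choose y hy hy0 using fun j => T.exists_toLaurent_regular (g j) h
    refine ⟨y, fun j => (hy j).trans (by simp), ?_⟩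
    by_contra! hcon
    obtain ⟨α, hα⟩ := hg
    have := congrArg (eval (PowerSeries.constantCoeff (T.expansion k))) hα
    rw [eval_finsetSum, eval_one, Finset.sum_eq_zero] at this
    · exact zero_ne_one this
    · intro j _
      rw [eval_mul, ← hy0, hcon, mul_zero]

end Coordinate

end

/-! ### Eigenvectors on a component of the spectral curve -/

/-- A row eigenvector of `L` on the curve `f = 0`, written by coprime polynomials in a coordinate
on the curve. -/
structure EigenRow {n : ℕ} (L : Matrix (Fin n) (Fin n) ℂ[X]) {f : ℂ[X][Y]} {m : ℕ} {κ : Type}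
    {br : κ → Branch f m} {k₀ : κ} (T : Coordinate br k₀) where
  /-- The entries. -/
  g : Fin n → ℂ[X]
  /-- The largest degree of an entry. -/
  N : ℕ
  natDegree_le : ∀ j, (g j).natDegree ≤ N
  exists_coeff_ne_zero : ∃ j, (g j).coeff N ≠ 0
  coprime : ∃ α : Fin n → ℂ[X], ∑ j, α j * g j = 1
  eigen : ∀ l, ∑ j, L j l • aeval T.t (g j) = AdjoinRoot.root f * aeval T.t (g l)

section

variable {n : ℕ} {L : Matrix (Fin n) (Fin n) ℂ[X]} {f : ℂ[X][Y]} {m : ℕ} {κ : Type}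
  {br : κ → Branch f m} {k₀ : κ} {T : Coordinate br k₀}

/-- On the component `μ` is a root of the characteristic polynomial, so `μ - L` is singular over the
domain and has a left kernel vector. -/
theorem exists_eigenRow_adjoinRoot [IsDomain (AdjoinRoot f)] (hL : f ∣ L.charpoly) :
    ∃ φ : Fin n → AdjoinRoot f, φ ≠ 0 ∧ ∀ l, ∑ j, L j l • φ j = AdjoinRoot.root f * φ l := by
  have hdet : (Matrix.scalar (Fin n) (AdjoinRoot.root f) - L.map (AdjoinRoot.of f)).det = 0 := by
    rw [← Matrix.eval_charpoly, Matrix.charpoly_map, eval_map,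
      ← AdjoinRoot.algebraMap_eq, ← aeval_def, AdjoinRoot.aeval_eq]
    exact AdjoinRoot.mk_eq_zero.2 hL
  obtain ⟨φ, h0, hφ⟩ := Matrix.exists_vecMul_eq_zero_iff.2 hdet
  refine ⟨φ, h0, fun l => ?_⟩
  have := congrFun hφ l
  rw [Matrix.vecMul_sub, Pi.sub_apply, Pi.zero_apply, sub_eq_zero] at this
  rw [Matrix.scalar_apply, Matrix.vecMul_diagonal] at this
  rw [mul_comm, this]
  simp only [Matrix.vecMul, dotProduct, Matrix.map_apply, Algebra.smul_def,
    AdjoinRoot.algebraMap_eq]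
  exact Finset.sum_congr rfl fun j _ => mul_comm _ _

theorem exists_coprime_of_ne_zero (g : Fin n → ℂ[X]) (hg : g ≠ 0) :
    ∃ (d : ℂ[X]) (h : Fin n → ℂ[X]), d ≠ 0 ∧ (∀ j, g j = d * h j) ∧
      ∃ α : Fin n → ℂ[X], ∑ j, α j * h j = 1 := by
  set d := Submodule.IsPrincipal.generator (Ideal.span (Set.range g)) with hd
  have hspan : Ideal.span {d} = Ideal.span (Set.range g) :=
    Ideal.span_singleton_generator _
  have hdvd : ∀ j, d ∣ g j := fun j => by
    rw [← Ideal.mem_span_singleton, hspan]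
    exact Ideal.subset_span ⟨j, rfl⟩
  choose h hh using hdvd
  have hd0 : d ≠ 0 := fun h0 => hg (funext fun j => by rw [hh j, h0, zero_mul]; rfl)
  obtain ⟨α, hα⟩ := Ideal.mem_span_range_iff_exists_fun.1
    (hspan ▸ Ideal.mem_span_singleton_self d : d ∈ Ideal.span (Set.range g))
  refine ⟨d, h, hd0, hh, α, mul_left_cancel₀ hd0 ?_⟩
  rw [Finset.mul_sum, mul_one]
  conv_rhs => rw [← hα]
  refine Finset.sum_congr rfl fun j _ => ?_
  rw [hh j]; ring

/-- An eigenrow over the coordinate ring becomes polynomial in `t` after clearing denominators, and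
its greatest common divisor can be cancelled in a domain. -/
theorem nonempty_eigenRow [Fintype κ] (hf : f.Monic) [IsDomain (AdjoinRoot f)] (hm : m ≠ 0)
    (hinj : Function.Injective fun k => (br k).value) (hcard : Fintype.card κ = f.natDegree)
    (hL : f ∣ L.charpoly) : Nonempty (EigenRow L T) := by
  classical
  obtain ⟨φ, hφ0, hφ⟩ := exists_eigenRow_adjoinRoot hL
  choose q p hq hp using fun j => T.exists_denominator hf hm hinj hcard (φ j)
  have hQ : ∀ j, aeval T.t (∏ i, q i) * φ j = aeval T.t ((∏ i ∈ Finset.univ.erase j, q i) * p j) :=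
    fun j => by
      rw [← Finset.mul_prod_erase _ _ (Finset.mem_univ j), map_mul, map_mul, ← hp]
      ring
  have hQ0 : aeval T.t (∏ i, q i) ≠ 0 := by
    rw [map_prod]
    exact Finset.prod_ne_zero_iff.2 fun j _ => (hq j).ne_zero
  obtain ⟨d, g, hd, hg, α, hα⟩ := exists_coprime_of_ne_zero
    (fun j => (∏ i ∈ Finset.univ.erase j, q i) * p j) (fun h => hφ0 (funext fun j => by
      have := hQ j
      rw [show (∏ i ∈ Finset.univ.erase j, q i) * p j = 0 from congrFun h j, map_zero] at this
      exact (mul_eq_zero.1 this).resolve_left hQ0))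
  have hd0 : aeval T.t d ≠ 0 := fun h => hd (T.aeval_injective (h.trans (map_zero _).symm))
  have hne : ∃ j, g j ≠ 0 := by
    by_contra! h
    simp [h] at hα
  have hn : (Finset.univ : Finset (Fin n)).Nonempty := ⟨hne.choose, Finset.mem_univ _⟩
  obtain ⟨j₀, -, hj₀⟩ := Finset.exists_max_image Finset.univ (fun j => (g j).natDegree) hn
  refine ⟨⟨g, (g j₀).natDegree, fun j => hj₀ j (Finset.mem_univ _), ?_, ⟨α, hα⟩, fun l => ?_⟩⟩
  -- `natDegree` does not distinguish `0` from constants: a maximal entry may be `0`, and then any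
  -- nonzero entry is a constant.
  · by_cases h : g j₀ = 0
    · obtain ⟨j, hj⟩ := hne
      have := hj₀ j (Finset.mem_univ _)
      rw [h, natDegree_zero, Nat.le_zero] at this
      refine ⟨j, ?_⟩
      rw [h, natDegree_zero, ← this]
      exact leadingCoeff_ne_zero.2 hj
    · exact ⟨j₀, leadingCoeff_ne_zero.2 h⟩
  · apply mul_left_cancel₀ hd0
    have key : ∀ j, aeval T.t d * aeval T.t (g j) = aeval T.t (∏ i, q i) * φ j := fun j => by
      rw [← map_mul, ← hg, hQ]
    rw [mul_left_comm, key, Finset.mul_sum, mul_left_comm, ← hφ, Finset.mul_sum]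
    refine Finset.sum_congr rfl fun j _ => ?_
    rw [mul_smul_comm, mul_smul_comm, key]

namespace EigenRow

variable (R : EigenRow L T)

/-- The pairing of column vectors with the eigenvector. -/
def pairing : (Fin n → ℂ[X]) →ₗ[ℂ[X]] AdjoinRoot f :=
  Fintype.linearCombination ℂ[X] fun j => aeval T.t (R.g j)

theorem pairing_apply (c : Fin n → ℂ[X]) : R.pairing c = ∑ j, c j • aeval T.t (R.g j) :=
  Fintype.linearCombination_apply ..

theorem pairing_mulVec (c : Fin n → ℂ[X]) :
    R.pairing (L *ᵥ c) = AdjoinRoot.root f * R.pairing c := by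
  simp only [pairing_apply, Matrix.mulVec, dotProduct, Finset.sum_smul, Finset.mul_sum]
  rw [Finset.sum_comm]
  refine Finset.sum_congr rfl fun l _ => ?_
  rw [mul_smul_comm, ← R.eigen, Finset.smul_sum]
  refine Finset.sum_congr rfl fun j _ => ?_
  rw [mul_comm, mul_smul]

theorem pairing_aeval_mulVec (q : ℂ[X][Y]) (c : Fin n → ℂ[X]) :
    R.pairing ((aeval L q) *ᵥ c) = AdjoinRoot.mk f q * R.pairing c := by
  induction q using Polynomial.induction_on generalizing c with
  | C a =>
    rw [aeval_C, Algebra.algebraMap_eq_smul_one, Matrix.smul_mulVec, Matrix.one_mulVec, map_smul,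
      AdjoinRoot.mk_C, Algebra.smul_def, AdjoinRoot.algebraMap_eq]
  | add p q hp hq => rw [map_add, Matrix.add_mulVec, map_add, hp, hq, map_add, add_mul]
  | monomial k a ih =>
    rw [pow_succ, ← mul_assoc, map_mul, aeval_X, ← Matrix.mulVec_mulVec, ih, pairing_mulVec,
      map_mul _ _ X, AdjoinRoot.mk_X, mul_assoc]

/-- The image is stable under `λ` and `μ`, hence an ideal, and it contains the coprime entries of
the eigenrow. -/
theorem pairing_surjective : Function.Surjective R.pairing := by
  have key : ∀ (x : AdjoinRoot f) (j : Fin n), ∃ c, R.pairing c = x * aeval T.t (R.g j) := by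
    intro x j
    obtain ⟨q, rfl⟩ := AdjoinRoot.mk_surjective x
    refine ⟨(aeval L q) *ᵥ Pi.single j 1, ?_⟩
    rw [pairing_aeval_mulVec, pairing_apply]
    simp [Pi.single_apply]
  intro u
  obtain ⟨α, hα⟩ := R.coprime
  choose c hc using fun j => key (u * aeval T.t (α j)) j
  refine ⟨∑ j, c j, ?_⟩
  rw [map_sum, ← mul_one u, ← map_one (aeval (R := ℂ) T.t), ← hα, map_sum, Finset.mul_sum]
  refine Finset.sum_congr rfl fun j _ => ?_
  rw [hc, map_mul, mul_assoc]

/-- By surjectivity `1, t, …, t ^ N` span over `ℂ[λ]` the coordinate ring, which is free of rank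
`deg f`. -/
theorem natDegree_le_succ (hf : f.Monic) : f.natDegree ≤ R.N + 1 := by
  have hspan : Submodule.span ℂ[X] (Set.range fun i : Fin (R.N + 1) => T.t ^ (i : ℕ)) = ⊤ := by
    rw [eq_top_iff]
    rintro u -
    obtain ⟨c, rfl⟩ := R.pairing_surjective u
    rw [pairing_apply]
    refine Submodule.sum_mem _ fun j _ => Submodule.smul_mem _ _ ?_
    rw [aeval_eq_sum_range' (Nat.lt_succ_of_le (R.natDegree_le j))]
    refine Submodule.sum_mem _ fun i hi => ?_
    rw [Algebra.smul_def, IsScalarTower.algebraMap_apply ℂ ℂ[X] (AdjoinRoot f), ← Algebra.smul_def]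
    exact Submodule.smul_mem _ _ (Submodule.subset_span ⟨⟨i, Finset.mem_range.1 hi⟩, rfl⟩)
  have := finrank_range_le_card (R := ℂ[X]) fun i : Fin (R.N + 1) => T.t ^ (i : ℕ)
  rw [Set.finrank, hspan, finrank_top, Fintype.card_fin,
    (AdjoinRoot.powerBasis' hf).finrank, AdjoinRoot.powerBasis'_dim] at this
  exact this

end EigenRow

end

/-! ### Growth of antiholomorphic involutions preserving a matrix polynomial -/

theorem exists_norm_eval_le (q : ℂ[X]) {m : ℕ} (hq : q.natDegree ≤ m) :
    ∃ K : ℝ, 0 ≤ K ∧ ∀ z, ‖q.eval z‖ ≤ K * (1 + ‖z‖) ^ m := by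
  refine ⟨∑ i ∈ Finset.range (m + 1), ‖q.coeff i‖, Finset.sum_nonneg fun _ _ => norm_nonneg _,
    fun z => ?_⟩
  rw [eval_eq_sum_range' (Nat.lt_succ_of_le hq), Finset.sum_mul]
  refine (norm_sum_le _ _).trans (Finset.sum_le_sum fun i hi => ?_)
  rw [norm_mul, norm_pow]
  gcongr
  calc ‖z‖ ^ i ≤ (1 + ‖z‖) ^ i := by gcongr; linarith
    _ ≤ (1 + ‖z‖) ^ m := pow_le_pow_right₀ (by linarith [norm_nonneg z])
      (by rw [Finset.mem_range] at hi; omega)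

theorem exists_norm_pow_le (p : ℂ[X]) (hp : p.natDegree ≠ 0) :
    ∃ K : ℝ, 0 ≤ K ∧ ∀ w, ‖w‖ ^ p.natDegree ≤ K * (1 + ‖p.eval w‖) := by
  obtain ⟨k, hk⟩ := Nat.exists_eq_succ_of_ne_zero hp
  have ha : 0 < ‖p.leadingCoeff‖ := by
    rw [norm_pos_iff, leadingCoeff_ne_zero]
    rintro rfl
    simp at hp
  set a := ‖p.leadingCoeff‖ with haa
  obtain ⟨K, hK, hr⟩ := exists_norm_eval_le p.eraseLead (m := k)
    ((eraseLead_natDegree_le p).trans (by omega))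
  -- Beyond `x₀` the lower terms, at most `K 2 ^ k ‖w‖ ^ k`, are at most half of the leading term `a
  -- ‖w‖ ^ (k + 1)`.
  set x₀ : ℝ := 1 + K * 2 ^ (k + 1) / a with hx₀
  have hx₀1 : 1 ≤ x₀ := by
    have : 0 ≤ K * 2 ^ (k + 1) / a := by positivity
    linarith
  refine ⟨x₀ ^ (k + 1) + 2 / a, by positivity, fun w => ?_⟩
  rw [hk, Nat.succ_eq_add_one]
  have hsplit : p.eval w = p.eraseLead.eval w + p.leadingCoeff * w ^ (k + 1) := by
    conv_lhs => rw [← p.eraseLead_add_monomial_natDegree_leadingCoeff]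
    rw [eval_add, eval_monomial, hk]
  have hlow : a * ‖w‖ ^ (k + 1) ≤ ‖p.eval w‖ + K * (1 + ‖w‖) ^ k := by
    rw [haa, ← norm_pow, ← norm_mul]
    have : p.leadingCoeff * w ^ (k + 1) = p.eval w - p.eraseLead.eval w := by rw [hsplit]; ring
    rw [this]
    exact (norm_sub_le _ _).trans (by gcongr; exact hr w)
  by_cases hw : ‖w‖ ≤ x₀
  · calc ‖w‖ ^ (k + 1) ≤ x₀ ^ (k + 1) := by gcongr
      _ ≤ (x₀ ^ (k + 1) + 2 / a) * 1 := by
        rw [mul_one]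
        have : 0 ≤ 2 / a := by positivity
        linarith
      _ ≤ _ := by gcongr; linarith [norm_nonneg (p.eval w)]
  · push Not at hw
    have h1 : (1 + ‖w‖) ^ k ≤ 2 ^ k * ‖w‖ ^ k := by
      rw [← mul_pow]; gcongr; linarith
    have h2 : K * 2 ^ (k + 1) ≤ a * ‖w‖ := by
      have : K * 2 ^ (k + 1) / a ≤ ‖w‖ := by linarith
      rw [div_le_iff₀ ha] at this
      linarith
    have h3 : 2 * (K * (1 + ‖w‖) ^ k) ≤ a * ‖w‖ ^ (k + 1) := by
      calc 2 * (K * (1 + ‖w‖) ^ k) ≤ 2 * (K * (2 ^ k * ‖w‖ ^ k)) := by gcongr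
        _ = K * 2 ^ (k + 1) * ‖w‖ ^ k := by ring
        _ ≤ a * ‖w‖ * ‖w‖ ^ k := by gcongr
        _ = a * ‖w‖ ^ (k + 1) := by ring
    have h4 : ‖w‖ ^ (k + 1) ≤ 2 / a * ‖p.eval w‖ := by
      rw [div_mul_eq_mul_div, le_div_iff₀ ha]
      linarith
    calc ‖w‖ ^ (k + 1) ≤ 2 / a * ‖p.eval w‖ := h4
      _ ≤ (x₀ ^ (k + 1) + 2 / a) * (1 + ‖p.eval w‖) := by
        gcongr
        · have : 0 ≤ x₀ ^ (k + 1) := by positivity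
          linarith
        · linarith

variable {n m : ℕ} {B : Matrix (Fin n) (Fin n) ℂ} {τ : ℂ → ℂ} {σ : ℂ}
  {L : Matrix (Fin n) (Fin n) ℂ[X]}

theorem natDegree_le_of_mem_realPencils (hL : L ∈ realPencils m B τ σ) (i j : Fin n) :
    (L i j).natDegree ≤ m :=
  natDegree_le_iff_coeff_eq_zero.2 fun k hk => congrFun (congrFun (hL.1 k hk) i) j

/-- An entry with `B i j ≠ 0` has degree exactly `m`, and `|L_ij(τ z)| = |L_ji(z)|` grows at most
like `|z| ^ m`, so `τ` grows at most linearly. -/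
theorem exists_norm_involution_le (hσ : ‖σ‖ = 1) (hm : m ≠ 0) (hB : B ≠ 0)
    (hL : L ∈ realPencils m B τ σ) : ∃ K : ℝ, ∀ z, ‖τ z‖ ≤ K * (1 + ‖z‖) := by
  obtain ⟨i, j, hij⟩ : ∃ i j, B i j ≠ 0 := by
    by_contra! h
    exact hB (Matrix.ext h)
  have hcoeff : (L i j).coeff m = B i j := congrFun (congrFun hL.2.1 i) j
  have hdeg : (L i j).natDegree = m :=
    le_antisymm (natDegree_le_of_mem_realPencils hL i j)
      (le_natDegree_of_ne_zero (by rwa [hcoeff]))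
  obtain ⟨K, hK, h1⟩ := exists_norm_pow_le (L i j) (by rwa [hdeg])
  obtain ⟨K', hK', h2⟩ := exists_norm_eval_le (L j i) (natDegree_le_of_mem_realPencils hL j i)
  rw [hdeg] at h1
  set D := 1 + K * (1 + K') with hD
  have hD1 : 1 ≤ D := by
    have : 0 ≤ K * (1 + K') := by positivity
    linarith
  refine ⟨D, fun z => ?_⟩
  refine le_of_pow_le_pow_left₀ hm (by positivity) ?_
  have hz1 : (1 : ℝ) ≤ (1 + ‖z‖) ^ m := one_le_pow₀ (by linarith [norm_nonneg z])
  have heq : ‖(L i j).eval (τ z)‖ = ‖(L j i).eval z‖ := by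
    have := congrFun (congrFun (hL.2.2 z) i) j
    simp only [evalAt, Matrix.map_apply, Matrix.smul_apply, Matrix.conjTranspose_apply,
      smul_eq_mul] at this
    rw [this, norm_mul, hσ, one_mul, norm_star]
  calc ‖τ z‖ ^ m ≤ K * (1 + ‖(L i j).eval (τ z)‖) := h1 _
    _ ≤ K * ((1 + ‖z‖) ^ m + K' * (1 + ‖z‖) ^ m) := by rw [heq]; gcongr; exact h2 z
    _ = K * (1 + K') * (1 + ‖z‖) ^ m := by ring
    _ ≤ D ^ m * (1 + ‖z‖) ^ m := by
      gcongr
      calc K * (1 + K') ≤ D := by linarith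
        _ ≤ D ^ m := le_self_pow₀ hD1 hm
    _ = (D * (1 + ‖z‖)) ^ m := (mul_pow _ _ _).symm

/-- An antiholomorphic map of linear growth is affine in `z̄`. -/
theorem exists_eq_mul_conj_add (hτ : Differentiable ℂ fun z => conj (τ z)) {K : ℝ}
    (hK : ∀ z, ‖τ z‖ ≤ K * (1 + ‖z‖)) : ∃ a b : ℂ, ∀ z, τ z = a * conj z + b := by
  set g : ℂ → ℂ := fun z => conj (τ z) with hg
  have hK0 : 0 ≤ K := by
    have := (norm_nonneg _).trans (hK 0)
    simpa using this
  -- Cauchy's estimate on the circle of radius `1 + ‖z‖`, where `1 + ‖w‖ ≤ 3 (1 + ‖z‖)`; by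
  -- Liouville the derivative is then constant.
  have hbound : ∀ z, ‖deriv g z‖ ≤ 3 * K := by
    intro z
    have hR : 0 < 1 + ‖z‖ := by positivity
    have := Complex.norm_deriv_le_of_forall_mem_sphere_norm_le (c := z) (R := 1 + ‖z‖)
      (C := 3 * K * (1 + ‖z‖)) hR hτ.diffContOnCl (fun w hw => by
        rw [hg]
        simp only [RCLike.norm_conj]
        refine (hK w).trans ?_
        have : ‖w‖ ≤ ‖z‖ + (1 + ‖z‖) := by
          rw [mem_sphere_iff_norm] at hw
          calc ‖w‖ = ‖z + (w - z)‖ := by ring_nf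
            _ ≤ ‖z‖ + ‖w - z‖ := norm_add_le _ _
            _ = _ := by rw [hw]
        have h2 : 1 + ‖w‖ ≤ 3 * (1 + ‖z‖) := by linarith [norm_nonneg z]
        calc K * (1 + ‖w‖) ≤ K * (3 * (1 + ‖z‖)) := by gcongr
          _ = _ := by ring)
    rwa [mul_div_cancel_right₀ _ hR.ne'] at this
  have hconst : ∀ z, deriv g z = deriv g 0 := fun z => by
    have hd : Differentiable ℂ (deriv g) :=
      (hτ.contDiff (n := 2)).differentiable_deriv_two
    refine hd.apply_eq_apply_of_bounded ?_ z 0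
    rw [isBounded_iff_forall_norm_le]
    exact ⟨3 * K, by rintro _ ⟨w, rfl⟩; exact hbound w⟩
  have hlin : ∀ z, g z = deriv g 0 * z + g 0 := fun z => by
    have := is_const_of_deriv_eq_zero (f := fun z => g z - deriv g 0 * z)
      (hτ.sub (differentiable_id.const_mul _)) (fun w => by
        have h1 : HasDerivAt (fun z => g z - deriv g 0 * z) (deriv g w - deriv g 0 * 1) w :=
          (hτ w).hasDerivAt.sub ((hasDerivAt_id w).const_mul _)
        rw [h1.deriv, hconst w]
        ring) z 0
    simp only [mul_zero, sub_zero] at this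
    rw [← this]; ring
  refine ⟨conj (deriv g 0), conj (g 0), fun z => ?_⟩
  have := congrArg conj (hlin z)
  rw [map_add, map_mul] at this
  rw [← this, hg]
  simp

/-- The fixed points of an affine antiholomorphic involution are not isolated. -/
theorem mem_closure_fixedPoints_diff (hinv : Function.Involutive τ) {a b : ℂ}
    (hab : ∀ z, τ z = a * conj z + b) {z₀ : ℂ} (hz₀ : τ z₀ = z₀) {T : Set ℂ} (hT : T.Finite) :
    z₀ ∈ closure ({z | τ z = z} \ T) := by
  have hshift : ∀ h, τ (z₀ + h) = z₀ + a * conj h := fun h => by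
    conv_rhs => rw [← hz₀]
    rw [hab, hab, map_add]; ring
  have haa : a * conj a = 1 := by
    have := hinv (z₀ + 1)
    rw [hshift, hshift] at this
    simpa using this
  -- A direction fixed by `h ↦ a h̄`: `1 + a` works since `a ā = 1`, unless it vanishes. The real
  -- line `z₀ + ℝ h` then consists of fixed points.
  obtain ⟨h, h0, hh⟩ : ∃ h : ℂ, h ≠ 0 ∧ a * conj h = h := by
    by_cases h1 : 1 + a = 0
    · refine ⟨Complex.I, Complex.I_ne_zero, ?_⟩
      rw [eq_neg_of_add_eq_zero_right h1, Complex.conj_I]; ring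
    · refine ⟨1 + a, h1, ?_⟩
      rw [map_add, map_one, mul_add, haa]; ring
  have hcont : Continuous fun x : ℝ => z₀ + x * h := by fun_prop
  have hinj : Function.Injective fun x : ℝ => z₀ + x * h := fun x y hxy => by
    simpa [h0] using hxy
  have hd : (0 : ℝ) ∈ closure ((fun x : ℝ => z₀ + x * h) ⁻¹' T)ᶜ :=
    (Set.Finite.preimage hinj.injOn hT).countable.dense_compl ℝ 0
  have := map_mem_closure hcont hd (t := {z | τ z = z} \ T) (fun x hx => by
    refine ⟨?_, hx⟩
    simp only [Set.mem_ofPred_eq, hshift, map_mul, Complex.conj_ofReal]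
    linear_combination (x : ℂ) * hh)
  simpa using this

/-- A polynomial dominated by `r` on a set without isolated points containing the roots of `r` is
divisible by `r`. -/
theorem dvd_of_norm_eval_le {S : Set ℂ}
    (hS : ∀ z ∈ S, ∀ T : Set ℂ, T.Finite → z ∈ closure (S \ T)) (r : ℂ[X]) (hr : r ≠ 0)
    (hroots : ∀ z, r.IsRoot z → z ∈ S) (g : ℂ[X]) {T : Set ℂ} (hT : T.Finite)
    (h : ∀ z ∈ S \ T, ‖g.eval z‖ ≤ ‖r.eval z‖) : r ∣ g := by
  induction hd : r.natDegree generalizing r g T with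
  | zero =>
    rw [eq_C_of_natDegree_eq_zero hd] at hr ⊢
    exact (isUnit_C.2 (isUnit_iff_ne_zero.2 (by simpa using hr))).dvd
  | succ d ih =>
    obtain ⟨z₀, hz₀⟩ := IsAlgClosed.exists_root r (by
      rw [degree_eq_natDegree hr, hd]; exact_mod_cast Nat.succ_ne_zero d)
    obtain ⟨r₁, rfl⟩ := dvd_iff_isRoot.2 hz₀
    -- The bound extends to `z₀` by continuity, so `g` vanishes there too; the factor `X - z₀` is
    -- cancelled from both sides at the cost of excluding `z₀`.
    have hg0 : g.IsRoot z₀ := by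
      have hcl : IsClosed {z | ‖g.eval z‖ ≤ ‖((X - C z₀) * r₁).eval z‖} :=
        isClosed_le g.continuous.norm (Polynomial.continuous _).norm
      have : ‖g.eval z₀‖ ≤ ‖((X - C z₀) * r₁).eval z₀‖ := closure_minimal (fun z hz => h z hz) hcl
        (hS z₀ (hroots z₀ hz₀) T hT)
      simpa using this
    obtain ⟨g₁, rfl⟩ := dvd_iff_isRoot.2 hg0
    have hr₁ : r₁ ≠ 0 := right_ne_zero_of_mul hr
    refine mul_dvd_mul_left _ (ih r₁ hr₁ (fun z hz => hroots z ?_) g₁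
      (hT.union (Set.finite_singleton z₀)) (fun z hz => ?_) ?_)
    · rw [IsRoot, eval_mul, hz.eq_zero, mul_zero]
    · have hne : z ≠ z₀ := fun h => hz.2 (Or.inr h)
      have := h z ⟨hz.1, fun h => hz.2 (Or.inl h)⟩
      rw [eval_mul, eval_mul, norm_mul, norm_mul] at this
      refine le_of_mul_le_mul_left this ?_
      simpa [sub_eq_zero] using hne
    · rw [natDegree_mul (X_sub_C_ne_zero z₀) hr₁, natDegree_X_sub_C] at hd
      omega

/-! ### Spectral projectors -/

section

variable {n m : ℕ} {B : Matrix (Fin n) (Fin n) ℂ} {τ : ℂ → ℂ} {σ : ℂ}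
  {L : Matrix (Fin n) (Fin n) ℂ[X]}

open scoped ComplexOrder in
/-- The entries of a normal matrix `G` with `G ^ 2 = ρ G` are bounded by `‖ρ‖`. -/
theorem norm_entry_le_of_normal {G : Matrix (Fin n) (Fin n) ℂ} {ρ : ℂ} (hρ : ρ ≠ 0)
    (hG : G * G = ρ • G) (hN : Commute G Gᴴ) (i j : Fin n) : ‖G i j‖ ≤ ‖ρ‖ := by
  set E := ρ⁻¹ • G with hE
  have hEE : E * E = E := by
    rw [hE, smul_mul_smul_comm, hG, smul_smul, mul_assoc, inv_mul_cancel₀ hρ, mul_one]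
  have hEN : E * Eᴴ = Eᴴ * E := by
    rw [hE, Matrix.conjTranspose_smul, smul_mul_smul_comm, smul_mul_smul_comm, hN.eq, mul_comm]
  have hEE' : Eᴴ * Eᴴ = Eᴴ := by rw [← Matrix.conjTranspose_mul, hEE]
  -- A normal idempotent is an orthogonal projection. The diagonal entry is then the squared norm of
  -- its column, which bounds all entries by `1`.
  have hproj : E = Eᴴ * E := by
    have h0 : (E - Eᴴ * E)ᴴ * (E - Eᴴ * E) = 0 := by
      rw [Matrix.conjTranspose_sub, Matrix.conjTranspose_mul, Matrix.conjTranspose_conjTranspose]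
      have h1 : Eᴴ * (Eᴴ * E) = Eᴴ * E := by rw [← mul_assoc, hEE']
      have h2 : Eᴴ * E * E = Eᴴ * E := by rw [mul_assoc, hEE]
      rw [sub_mul, mul_sub, mul_sub, h1, h2, ← mul_assoc (Eᴴ * E), mul_assoc Eᴴ E Eᴴ, hEN, h1, h2]
      simp
    exact sub_eq_zero.1 (Matrix.conjTranspose_mul_self_eq_zero.1 h0)
  have hsum : ∑ i, ‖E i j‖ ^ 2 = (E j j).re := by
    conv_rhs => rw [hproj]
    rw [Matrix.mul_apply, Complex.re_sum]
    refine Finset.sum_congr rfl fun i _ => ?_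
    rw [Matrix.conjTranspose_apply, mul_comm, Complex.star_def, Complex.mul_conj,
      Complex.ofReal_re, Complex.normSq_eq_norm_sq]
  have hle : ∀ i, ‖E i j‖ ^ 2 ≤ (E j j).re := fun i => by
    rw [← hsum]
    exact Finset.single_le_sum (f := fun i => ‖E i j‖ ^ 2) (fun _ _ => sq_nonneg _)
      (Finset.mem_univ i)
  have hre : (E j j).re ≤ 1 := by
    have h1 := hle j
    have h2 := Complex.re_le_norm (E j j)
    nlinarith [norm_nonneg (E j j)]
  have h1 : ‖E i j‖ ≤ 1 := by
    have := (hle i).trans hre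
    nlinarith [norm_nonneg (E i j)]
  rw [hE, Matrix.smul_apply, smul_eq_mul, norm_mul, norm_inv,
    inv_mul_le_iff₀ (norm_pos_iff.2 hρ), mul_one] at h1
  exact h1

theorem commute_aeval {R A : Type*} [CommSemiring R] [Semiring A] [Algebra R A] {x y : A}
    (h : Commute x y) (p : R[X]) : Commute x (aeval y p) := by
  induction p using Polynomial.induction_on with
  | C a => rw [aeval_C]; exact (Algebra.commutes a x).symm
  | add p q hp hq => rw [map_add]; exact hp.add_right hq
  | monomial k a ih => rw [pow_succ, ← mul_assoc, map_mul, aeval_X]; exact ih.mul_right h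

/-- Normality is inherited by polynomials in `M`, since `M` is a multiple of its adjoint. -/
theorem commute_conjTranspose_aeval {M : Matrix (Fin n) (Fin n) ℂ}
    (hM : M = σ • Mᴴ) (p : ℂ[X]) : Commute (aeval M p) (aeval M p)ᴴ := by
  have h1 : Commute (aeval M p)ᴴ Mᴴ := by
    have := (commute_aeval (Commute.refl M) p).eq
    have h2 := congrArg Matrix.conjTranspose this
    rw [Matrix.conjTranspose_mul, Matrix.conjTranspose_mul] at h2
    exact h2
  have h2 : Commute (aeval M p)ᴴ M := by
    rw [hM]
    refine Commute.smul_right ?_ σ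
    rw [← hM]
    exact h1
  exact (commute_aeval h2 p).symm

theorem evalAt_eq_mapMatrix (M : Matrix (Fin n) (Fin n) ℂ[X]) (z : ℂ) :
    evalAt M z = (evalRingHom z).mapMatrix M := rfl

theorem evalAt_aeval (q : ℂ[X][Y]) (z : ℂ) :
    evalAt (aeval L q) z = aeval (evalAt L z) (q.map (evalRingHom z)) := by
  induction q using Polynomial.induction_on with
  | C a =>
    rw [aeval_C, map_C, aeval_C, evalAt_eq_mapMatrix, Matrix.algebraMap_eq_diagonal,
      Matrix.algebraMap_eq_diagonal, RingHom.mapMatrix_apply, Matrix.diagonal_map (map_zero _)]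
    rfl
  | add p q hp hq =>
    rw [map_add, evalAt_eq_mapMatrix, map_add, ← evalAt_eq_mapMatrix, ← evalAt_eq_mapMatrix, hp,
      hq, Polynomial.map_add, map_add]
  | monomial k a ih =>
    rw [pow_succ, ← mul_assoc, map_mul, aeval_X, evalAt_eq_mapMatrix, map_mul,
      ← evalAt_eq_mapMatrix, ← evalAt_eq_mapMatrix, ih, Polynomial.map_mul _ (q := X), map_X,
      map_mul, aeval_X]

/-- A Bezout relation `a f + b h = r(λ)` such that `f` and `h` have a common zero over each root
of `r`. -/
theorem exists_bezout_minimal {f h : ℂ[X][Y]}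
    (hfh : ∃ r₀ : ℂ[X], r₀ ≠ 0 ∧ C r₀ ∈ Ideal.span {f, h}) :
    ∃ (a b : ℂ[X][Y]) (r : ℂ[X]), r ≠ 0 ∧ a * f + b * h = C r ∧
      ∀ z, r.IsRoot z → ∃ y, f.evalEval z y = 0 ∧ h.evalEval z y = 0 := by
  obtain ⟨r₀, hr₀, hmem⟩ := hfh
  set J : Ideal ℂ[X] := (Ideal.span {f, h}).comap C with hJ
  set r := Submodule.IsPrincipal.generator J with hr
  have hJr : ∀ q, C q ∈ Ideal.span {f, h} → r ∣ q := fun q hq => by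
    rw [← Ideal.mem_span_singleton, hr, Ideal.span_singleton_generator]
    exact hq
  have hr0 : r ≠ 0 := fun h0 => by
    have := hJr r₀ hmem
    rw [h0, zero_dvd_iff] at this
    exact hr₀ this
  have hrmem : C r ∈ Ideal.span {f, h} := Submodule.IsPrincipal.generator_mem J
  obtain ⟨a, b, hab⟩ := Ideal.mem_span_pair.1 hrmem
  refine ⟨a, b, r, hr0, hab, fun z hz => ?_⟩
  -- Without a common zero over `z` the fibres are coprime, and a Bezout relation between them puts
  -- `r / (λ - z)` into the ideal, against the choice of `r` as a generator of the elimination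
  -- ideal.
  by_contra! hcon
  have hcop : IsCoprime (f.map (evalRingHom z)) (h.map (evalRingHom z)) := by
    refine IsCoprime.symm ?_
    rw [Polynomial.isCoprime_iff_aeval_ne_zero_of_isAlgClosed ℂ ℂ]
    intro y
    by_contra! hy
    refine hcon y ?_ ?_
    · rw [← map_evalRingHom_eval]
      simpa using hy.2
    · rw [← map_evalRingHom_eval]
      simpa using hy.1
  obtain ⟨α, β, hαβ⟩ := hcop
  obtain ⟨g₁, hg₁⟩ := exists_eq_C_X_sub_C_mul f z
  obtain ⟨g₂, hg₂⟩ := exists_eq_C_X_sub_C_mul h z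
  obtain ⟨r', hr'⟩ := dvd_iff_isRoot.2 hz
  have hone : (α.map C * (f.map (evalRingHom z)).map C + β.map C * (h.map (evalRingHom z)).map C :
      ℂ[X][Y]) = 1 := by
    rw [← Polynomial.map_mul, ← Polynomial.map_mul, ← Polynomial.map_add, hαβ, Polynomial.map_one]
  have hmem' : C r' ∈ Ideal.span {f, h} := by
    have hC : (C r : ℂ[X][Y]) = C (X - C z) * C r' := by rw [← C_mul, ← hr']
    refine Ideal.mem_span_pair.2 ⟨C r' * α.map C - a * (α.map C * g₁ + β.map C * g₂),
      C r' * β.map C - b * (α.map C * g₁ + β.map C * g₂), ?_⟩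
    linear_combination (C r' * α.map C) * hg₁ + (C r' * β.map C) * hg₂ + C r' * hone -
      (α.map C * g₁ + β.map C * g₂) * hab - (α.map C * g₁ + β.map C * g₂) * hC
  have hdvd := hJr r' hmem'
  have hr'0 : r' ≠ 0 := fun h0 => hr0 (by rw [hr', h0, mul_zero])
  have := natDegree_le_of_dvd hdvd hr'0
  rw [hr', natDegree_mul (X_sub_C_ne_zero z) hr'0, natDegree_X_sub_C] at this
  omega

theorem spectralPoly_eq : spectralPoly L = (-1) ^ n * L.charpoly := by
  have : L.map C - (Y : ℂ[X][Y]) • (1 : Matrix (Fin n) (Fin n) ℂ[X][Y]) = -L.charmatrix := by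
    rw [Matrix.charmatrix, neg_sub, Matrix.scalar_apply, Matrix.smul_one_eq_diagonal]
    rfl
  rw [spectralPoly, this, Matrix.det_neg, Fintype.card_fin, Matrix.charpoly]

/-- By the product rule, both partial derivatives vanish where two factors vanish. -/
theorem mem_singularSet_of_common_zero {f h c : ℂ[X][Y]} {z y : ℂ} (hf : f.evalEval z y = 0)
    (hh : h.evalEval z y = 0) : (z, y) ∈ singularSet (c * (f * h)) := by
  refine ⟨?_, ?_, ?_⟩
  · simp [zeroSet, evalEval_mul, hf]
  · simp only [evalEval] at hf hh
    simp [partialFst, derivative_mul, hf, hh]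
  · simp [partialSnd, derivative_mul, evalEval_mul, evalEval_add, hf, hh]

/-- The spectral projector of a factor of the characteristic polynomial is polynomial in `λ` when
the singular points of the spectral curve are real. -/
theorem exists_polynomial_projector (hτ : IsAntiholomorphicInvolution τ) (hσ : ‖σ‖ = 1)
    (hm : m ≠ 0) (hB : B ≠ 0) (hL : L ∈ realPencils m B τ σ)
    (hsing : singularSet (spectralPoly L) ⊆ Function.fixedPoints (tauHat τ σ))
    {f h : ℂ[X][Y]} (hfh : L.charpoly = f * h)
    (hcop : ∃ r₀ : ℂ[X], r₀ ≠ 0 ∧ C r₀ ∈ Ideal.span {f, h}) :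
    ∃ (E : Matrix (Fin n) (Fin n) ℂ[X]) (a b : ℂ[X][Y]) (r : ℂ[X]), r ≠ 0 ∧
      a * f + b * h = C r ∧ aeval L (b * h) = r • E := by
  obtain ⟨a, b, r, hr, hab, hroots⟩ := exists_bezout_minimal hcop
  obtain ⟨K, hK⟩ := exists_norm_involution_le hσ hm hB hL
  obtain ⟨α, β, hαβ⟩ := exists_eq_mul_conj_add hτ.antiholomorphic hK
  set G := aeval L (b * h) with hG
  -- By Cayley-Hamilton `f h` acts as zero, and modulo `f h` the element `b h` is `r` times an
  -- idempotent.
  have hGG : G * G = r • G := by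
    have h1 : (b * h) * (b * h) = C r * (b * h) + L.charpoly * (-(a * b)) := by
      rw [← hab, hfh]; ring
    rw [hG, ← map_mul, h1, map_add, map_mul _ L.charpoly, Matrix.aeval_self_charpoly, zero_mul,
      add_zero, map_mul, aeval_C, ← Algebra.smul_def]
  have hdvd : ∀ i j, r ∣ G i j := by
    intro i j
    refine dvd_of_norm_eval_le (S := {z | τ z = z})
      (fun z hz T hT => mem_closure_fixedPoints_diff hτ.involutive hαβ hz hT) r hr
      (fun z hz => ?_) (G i j) (T := {z | r.IsRoot z}) (finite_setOfPred_isRoot hr) ?_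
    · obtain ⟨y, hy1, hy2⟩ := hroots z hz
      have : (z, y) ∈ singularSet (spectralPoly L) := by
        rw [spectralPoly_eq, hfh]
        exact mem_singularSet_of_common_zero hy1 hy2
      exact congrArg Prod.fst (hsing this)
    -- At a fixed point of `τ` off the roots of `r`, `L_z` is normal, hence so is `G_z`, and the
    -- orthogonal projection `G_z / r(z)` is bounded.
    · rintro z ⟨hz, hrz⟩
      have hM : evalAt L z = σ • (evalAt L z)ᴴ := by
        conv_lhs => rw [← (hz : τ z = z)]
        exact hL.2.2 z
      refine norm_entry_le_of_normal (G := evalAt G z) hrz ?_ ?_ i j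
      · have := congrArg (evalRingHom z).mapMatrix hGG
        rw [map_mul] at this
        rw [evalAt_eq_mapMatrix, this]
        ext i j
        simp
      · rw [hG, evalAt_aeval]
        exact commute_conjTranspose_aeval hM _
  choose E hE using hdvd
  exact ⟨Matrix.of E, a, b, r, hr, hab, by ext1 i j; exact hE i j⟩

end

/-! ### Branches of the spectral curve at infinity -/

section

variable {n m : ℕ} {B : Matrix (Fin n) (Fin n) ℂ} {L : Matrix (Fin n) (Fin n) ℂ[X]}

theorem exists_root_powerSeries (p : ℂ⟦X⟧[X]) (hp : p.Monic) {b : ℂ}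
    (hb : (p.map PowerSeries.constantCoeff).IsRoot b)
    (hb' : ¬ (derivative (p.map PowerSeries.constantCoeff)).IsRoot b) :
    ∃ y, p.IsRoot y ∧ PowerSeries.constantCoeff y = b := by
  have key : ∀ q : ℂ⟦X⟧[X], PowerSeries.constantCoeff (q.eval (PowerSeries.C b)) =
      (q.map PowerSeries.constantCoeff).eval b := fun q => by
    rw [← Polynomial.eval₂_at_apply, PowerSeries.constantCoeff_C, eval_map]
  obtain ⟨y, hy, hy'⟩ := HenselianRing.is_henselian (I := Ideal.span {(PowerSeries.X : ℂ⟦X⟧)}) p hp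
    (PowerSeries.C b) (by
      rw [Ideal.mem_span_singleton, PowerSeries.X_dvd_iff, key]
      exact hb) (by
      refine IsUnit.map _ ?_
      rw [PowerSeries.isUnit_iff_constantCoeff, key, isUnit_iff_ne_zero, ← derivative_map]
      exact hb')
  refine ⟨y, hy, ?_⟩
  rw [Ideal.mem_span_singleton, PowerSeries.X_dvd_iff, map_sub, PowerSeries.constantCoeff_C,
    sub_eq_zero] at hy'
  exact hy'

theorem exists_powerSeries_matrix (hdeg : ∀ i j, (L i j).natDegree ≤ m)
    (hcoeff : matrixCoeff L m = B) : ∃ M : Matrix (Fin n) (Fin n) ℂ⟦X⟧,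
      M.map PowerSeries.constantCoeff = B ∧
        ∀ i j, toLaurent (M i j) = param ^ m * atInfinity (L i j) := by
  choose M hM hM0 using fun i j => exists_toLaurent_atInfinity (L i j) (hdeg i j)
  refine ⟨Matrix.of M, ?_, hM⟩
  ext i j
  rw [Matrix.map_apply, Matrix.of_apply, hM0, ← hcoeff]
  rfl

/-- The spectral curve has a branch at infinity for every simple eigenvalue of the leading
coefficient. -/
theorem exists_branch (hdeg : ∀ i j, (L i j).natDegree ≤ m) (hcoeff : matrixCoeff L m = B)
    (hB : B.charpoly.roots.Nodup) {b : ℂ} (hb : b ∈ B.charpoly.roots) :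
    ∃ β : Branch L.charpoly m, β.value = b := by
  -- `M = s ^ m L(1 / s)` reduces to `B` at `s = 0`, so a simple eigenvalue of `B` lifts by Hensel's
  -- lemma.
  obtain ⟨M, hM0, hM⟩ := exists_powerSeries_matrix hdeg hcoeff
  have hmap : M.charpoly.map PowerSeries.constantCoeff = B.charpoly := by
    rw [← Matrix.charpoly_map, ← hM0]
  have hroot : B.charpoly.IsRoot b := (mem_roots'.1 hb).2
  obtain ⟨y, hy, hyb⟩ := exists_root_powerSeries M.charpoly M.charpoly_monic (b := b)
    (by rwa [hmap]) (by
      rw [hmap]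
      intro h
      have h1 := (one_lt_rootMultiplicity_iff_isRoot B.charpoly_monic.ne_zero).2 ⟨hroot, h⟩
      rw [← count_roots] at h1
      exact absurd (Multiset.nodup_iff_count_le_one.1 hB b) (by omega))
  refine ⟨⟨y, ?_⟩, hyb⟩
  have h1 : (Matrix.scalar (Fin n) (toLaurent y) - M.map toLaurent).det = 0 := by
    rw [← Matrix.eval_charpoly, Matrix.charpoly_map, eval_map, eval₂_at_apply, hy.eq_zero, map_zero]
  have h2 : M.map toLaurent = param ^ m • L.map (atInfinity : ℂ[X] →+* ℂ⸨X⸩) := by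
    ext1 i j
    simp only [Matrix.map_apply, Matrix.smul_apply, smul_eq_mul, RingHom.coe_coe]
    exact hM i j
  have h3 : Matrix.scalar (Fin n) (param⁻¹ ^ m * toLaurent y) -
      L.map (atInfinity : ℂ[X] →+* ℂ⸨X⸩) =
      param⁻¹ ^ m • (Matrix.scalar (Fin n) (toLaurent y) - M.map toLaurent) := by
    ext1 i j
    simp only [h2, Matrix.sub_apply, Matrix.smul_apply, smul_eq_mul, Matrix.scalar_apply,
      Matrix.diagonal_apply, mul_sub, ← mul_assoc, ← mul_pow, inv_mul_cancel₀ param_ne_zero,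
      one_pow, one_mul, mul_ite, mul_zero]
  rw [← eval_map, ← Matrix.charpoly_map, Matrix.eval_charpoly, h3, Matrix.det_smul, h1, mul_zero]

/-- The roots of the characteristic polynomial in the field of Laurent series at infinity. -/
theorem exists_branches (hdeg : ∀ i j, (L i j).natDegree ≤ m) (hcoeff : matrixCoeff L m = B)
    (hB : B.charpoly.roots.Nodup) : ∃ br : Fin n → Branch L.charpoly m,
      Function.Injective fun k => (br k).value := by
  classical
  have hcard : Fintype.card {b // b ∈ B.charpoly.roots.toFinset} = n := by
    rw [Fintype.card_coe, Multiset.toFinset_card_of_nodup hB,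
      IsAlgClosed.card_roots_eq_natDegree, Matrix.charpoly_natDegree_eq_dim, Fintype.card_fin]
  let e : Fin n ≃ {b // b ∈ B.charpoly.roots.toFinset} :=
    (Fintype.equivFinOfCardEq hcard).symm
  choose br hbr using fun k => exists_branch hdeg hcoeff hB (Multiset.mem_toFinset.1 (e k).2)
  refine ⟨br, fun k l h => ?_⟩
  simp only [hbr] at h
  exact e.injective (Subtype.ext h)

theorem eq_of_root_eq {f g : ℂ[X][Y]} {β : Branch f m} {γ : Branch g m}
    (h : param⁻¹ ^ m * toLaurent β.nu = param⁻¹ ^ m * toLaurent γ.nu) : β.value = γ.value := by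
  have := mul_left_cancel₀ (pow_ne_zero _ (inv_ne_zero param_ne_zero)) h
  rw [Branch.value, Branch.value, toLaurent_injective this]

/-- A monic polynomial of degree `n` with `n` distinct roots is a product of distinct linear
factors. -/
theorem separable_map_of_branches {P : ℂ[X][Y]} (hP : P.Monic) (hn : P.natDegree = n)
    (br : Fin n → Branch P m) (hbr : Function.Injective fun k => (br k).value) :
    (P.map (atInfinity : ℂ[X] →+* ℂ⸨X⸩)).Separable := by
  have hinj : Function.Injective fun k => param⁻¹ ^ m * toLaurent (br k).nu :=
    fun k l h => hbr (eq_of_root_eq h)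
  have hdvd : ∏ k, (X - C (param⁻¹ ^ m * toLaurent (br k).nu)) ∣
      P.map (atInfinity : ℂ[X] →+* ℂ⸨X⸩) := by
    refine Finset.prod_dvd_of_coprime (fun k _ l _ hkl => pairwise_coprime_X_sub_C hinj hkl)
      fun k _ => ?_
    rw [dvd_iff_isRoot, IsRoot, eval_map]
    exact (br k).isRoot
  obtain ⟨c, hc⟩ := hdvd
  have hmon : (∏ k, (X - C (param⁻¹ ^ m * toLaurent (br k).nu))).Monic :=
    monic_prod_of_monic _ _ fun k _ => monic_X_sub_C _
  have hcm : c.Monic := hmon.of_mul_monic_left (hc ▸ hP.map _)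
  have hdeg := congrArg natDegree hc
  rw [hP.natDegree_map, hmon.natDegree_mul hcm, natDegree_finsetProd_X_sub_C_eq_card,
    Finset.card_univ, Fintype.card_fin, hn] at hdeg
  rw [hc, hcm.natDegree_eq_zero.1 (by omega), mul_one]
  exact separable_prod_X_sub_C_iff.2 hinj

/-- Separability descends to the fraction field, and denominators of the Bezout relation are
cleared; `r` plays the role of the discriminant. -/
theorem exists_C_mem_span_derivative {R S : Type*} [CommRing R] [IsDomain R] [Field S]
    (φ : R →+* S) (hφ : Function.Injective φ) {P : R[X]} (hP : (P.map φ).Separable) :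
    ∃ r : R, r ≠ 0 ∧ C r ∈ Ideal.span {P, derivative P} := by
  let K := FractionRing R
  have hψ : (IsFractionRing.lift (K := K) hφ).comp (algebraMap R K) = φ :=
    RingHom.ext fun x => IsFractionRing.lift_algebraMap hφ x
  rw [← hψ, ← Polynomial.map_map, separable_map] at hP
  obtain ⟨α, β, hαβ⟩ := hP
  obtain ⟨a, ha0, ha⟩ := IsLocalization.integerNormalization_spec (nonZeroDivisors R) α
  obtain ⟨b, hb0, hb⟩ := IsLocalization.integerNormalization_spec (nonZeroDivisors R) β
  generalize IsLocalization.integerNormalization (nonZeroDivisors R) α = α' at ha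
  generalize IsLocalization.integerNormalization (nonZeroDivisors R) β = β' at hb
  refine ⟨a * b, mul_ne_zero (nonZeroDivisors.ne_zero ha0) (nonZeroDivisors.ne_zero hb0),
    Ideal.mem_span_pair.2 ⟨C b * α', C a * β', ?_⟩⟩
  apply map_injective _ (IsFractionRing.injective R K)
  have hs : ∀ (x : R) (p : K[X]), x • p = C (algebraMap R K x) * p := fun x p => by
    rw [← smul_eq_C_mul, algebraMap_smul]
  simp only [Polynomial.map_add, Polynomial.map_mul, map_C, ha, hb, hs, map_mul, ← derivative_map]
  linear_combination C (algebraMap R K a) * C (algebraMap R K b) * hαβ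

/-- Distinct factors of a separable polynomial are coprime away from finitely many `λ`. -/
theorem exists_C_mem_span_of_mul {P f h : ℂ[X][Y]} (hP : P = f * h)
    (hsep : ∃ r : ℂ[X], r ≠ 0 ∧ C r ∈ Ideal.span {P, derivative P}) :
    ∃ r : ℂ[X], r ≠ 0 ∧ C r ∈ Ideal.span {f, h} := by
  obtain ⟨r, hr, hmem⟩ := hsep
  obtain ⟨a, b, hab⟩ := Ideal.mem_span_pair.1 hmem
  refine ⟨r, hr, Ideal.mem_span_pair.2 ⟨a * h + b * derivative h, b * derivative f, ?_⟩⟩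
  rw [← hab, hP, derivative_mul]
  ring

/-- Two monic polynomials with the same zeros and separable generic fibres are equal. -/
theorem eq_of_zeroSet_eq {P Q : ℂ[X][Y]} (hP : P.Monic) (hQ : Q.Monic)
    (hsepP : ∃ r : ℂ[X], r ≠ 0 ∧ C r ∈ Ideal.span {P, derivative P})
    (hsepQ : ∃ r : ℂ[X], r ≠ 0 ∧ C r ∈ Ideal.span {Q, derivative Q})
    (h : zeroSet P = zeroSet Q) : P = Q := by
  have fibre : ∀ {R : ℂ[X][Y]} {r : ℂ[X]}, C r ∈ Ideal.span {R, derivative R} → ∀ z,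
      r.eval z ≠ 0 → (R.map (evalRingHom z)).Separable := by
    intro R r hr z hz
    obtain ⟨a, b, hab⟩ := Ideal.mem_span_pair.1 hr
    have := congrArg (Polynomial.map (evalRingHom z)) hab
    rw [Polynomial.map_add, Polynomial.map_mul, Polynomial.map_mul, map_C, coe_evalRingHom,
      ← derivative_map] at this
    refine ⟨C (r.eval z)⁻¹ * a.map (evalRingHom z), C (r.eval z)⁻¹ * b.map (evalRingHom z), ?_⟩
    have hinv : (C (r.eval z)⁻¹ * C (r.eval z) : ℂ[X]) = 1 := by
      rw [← C_mul, inv_mul_cancel₀ hz, C_1]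
    linear_combination C (r.eval z)⁻¹ * this + hinv
  obtain ⟨r, hr0, hr⟩ := hsepP
  obtain ⟨s, hs0, hs⟩ := hsepQ
  -- Off the zeros of `r s` the fibres are monic, separable and have the same roots. Equality of the
  -- coefficients at infinitely many `λ` then suffices.
  have hfib : ∀ z, (r * s).eval z ≠ 0 → P.map (evalRingHom z) = Q.map (evalRingHom z) := by
    intro z hz
    rw [eval_mul] at hz
    have hsP := fibre hr z (left_ne_zero_of_mul hz)
    have hsQ := fibre hs z (right_ne_zero_of_mul hz)
    have hmP := hP.map (evalRingHom z)
    have hmQ := hQ.map (evalRingHom z)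
    have hroots : (P.map (evalRingHom z)).roots = (Q.map (evalRingHom z)).roots := by
      rw [Multiset.Nodup.ext (nodup_roots hsP) (nodup_roots hsQ)]
      intro y
      rw [mem_roots hmP.ne_zero, mem_roots hmQ.ne_zero, IsRoot, IsRoot, map_evalRingHom_eval,
        map_evalRingHom_eval]
      exact iff_of_eq (congrArg ((z, y) ∈ ·) h)
    rw [(IsAlgClosed.splits (P.map (evalRingHom z))).eq_prod_roots_of_monic hmP,
      (IsAlgClosed.splits (Q.map (evalRingHom z))).eq_prod_roots_of_monic hmQ, hroots]
  ext1 k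
  refine Polynomial.eq_of_infinite_eval_eq _ _ (Set.Infinite.mono (s := {z | (r * s).IsRoot z}ᶜ)
    (fun z hz => ?_) (finite_setOfPred_isRoot (mul_ne_zero hr0 hs0)).infinite_compl)
  have := congrArg (fun p => p.coeff k) (hfib z hz)
  simpa [coeff_map] using this

theorem exists_monic_irreducible_factors (P : ℂ[X][Y]) (hP : P.Monic) :
    ∃ (k : ℕ) (f : Fin k → ℂ[X][Y]), (∀ i, (f i).Monic ∧ Irreducible (f i)) ∧ P = ∏ i, f i := by
  induction hd : P.natDegree using Nat.strong_induction_on generalizing P with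
  | _ d ih =>
    by_cases h0 : d = 0
    · refine ⟨0, Fin.elim0, fun i => i.elim0, ?_⟩
      rw [hP.natDegree_eq_zero.1 (hd.trans h0)]
      rfl
    obtain ⟨g, hg, q, hq⟩ := WfDvdMonoid.exists_irreducible_factor (a := P)
      (fun hu => h0 (by rw [← hd, hP.eq_one_of_isUnit hu, natDegree_one])) hP.ne_zero
    have hlc : g.leadingCoeff * q.leadingCoeff = 1 := by
      rw [← leadingCoeff_mul, ← hq]; exact hP
    -- The two leading coefficients are mutually inverse units, so exchanging them makes both
    -- factors monic.
    set g' := C q.leadingCoeff * g with hg'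
    set q' := C g.leadingCoeff * q with hq'
    have hgm : g'.Monic := by
      rw [Monic, hg', leadingCoeff_mul, leadingCoeff_C, mul_comm, hlc]
    have hqm : q'.Monic := by
      rw [Monic, hq', leadingCoeff_mul, leadingCoeff_C, hlc]
    have hPq : P = g' * q' := by
      have : (C q.leadingCoeff * C g.leadingCoeff : ℂ[X][Y]) = 1 := by
        rw [← C_mul, mul_comm, hlc, C_1]
      rw [hq, hg', hq']
      linear_combination -g * q * this
    have hgi : Irreducible g' := by
      have hu : IsUnit (C q.leadingCoeff : ℂ[X][Y]) :=
        isUnit_C.2 (IsUnit.of_mul_eq_one _ ((mul_comm _ _).trans hlc))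
      exact (irreducible_isUnit_mul hu).2 hg
    have hpos : 0 < g'.natDegree := hgm.natDegree_pos.2 fun h => hgi.not_isUnit (h ▸ isUnit_one)
    obtain ⟨k, f, hf, hprod⟩ := ih q'.natDegree (by
      rw [← hd, hPq, hgm.natDegree_mul hqm]; omega) q' hqm rfl
    refine ⟨k + 1, Fin.cons g' f, fun i => ?_, ?_⟩
    · refine Fin.cases ⟨hgm, hgi⟩ (fun j => ?_) i
      exact hf j
    · rw [Fin.prod_univ_succ, hPq, hprod]
      rfl

end

/-! ### Reconstruction of a matrix polynomial from its spectral curve -/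

/-- The components of the curve `P = 0` with their branches at infinity and rational
coordinates. -/
structure RationalComponents (P : ℂ[X][Y]) (m k : ℕ) where
  /-- The equations of the components. -/
  f : Fin k → ℂ[X][Y]
  monic : ∀ i, (f i).Monic
  isDomain : ∀ i, IsDomain (AdjoinRoot (f i))
  prod_eq : P = ∏ i, f i
  /-- The points at infinity of the components. -/
  κ : Fin k → Type
  fintype : ∀ i, Fintype (κ i)
  /-- The branches at infinity of the components. -/
  br : ∀ i, κ i → Branch (f i) m
  card_eq : ∀ i, Fintype.card (κ i) = (f i).natDegree
  value_injective : Function.Injective fun x : Σ i, κ i => (br x.1 x.2).value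
  /-- The point at infinity where the coordinate has its pole. -/
  k₀ : ∀ i, κ i
  /-- The coordinates. -/
  T : ∀ i, Coordinate (br i) (k₀ i)

attribute [instance] RationalComponents.fintype RationalComponents.isDomain

/-- Row eigenvectors of a matrix for all its distinct eigenvalues separate vectors. -/
theorem eq_zero_of_eigenRows {n : ℕ} {B : Matrix (Fin n) (Fin n) ℂ} {ι : Type}
    [Fintype ι] (hι : Fintype.card ι = n)
    {b : ι → ℂ} (hb : Function.Injective b) {w : ι → Fin n → ℂ} (hw0 : ∀ x, w x ≠ 0)
    (hw : ∀ x, w x ᵥ* B = b x • w x) (c : Fin n → ℂ) (hc : ∀ x, ∑ j, w x j * c j = 0) : c = 0 := by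
  have hli : LinearIndependent ℂ w :=
    Module.End.eigenvectors_linearIndependent' (Matrix.toLin' Bᵀ) b hb w fun x => by
      rw [Module.End.hasEigenvector_iff, Module.End.mem_eigenspace_iff]
      refine ⟨?_, hw0 x⟩
      rw [Matrix.toLin'_apply, Matrix.mulVec_transpose, hw]
  have hspan := hli.span_eq_top_of_card_eq_finrank' (by simp [hι])
  have hall : ∀ v : Fin n → ℂ, v ⬝ᵥ c = 0 := by
    intro v
    have hv : v ∈ Submodule.span ℂ (Set.range w) := hspan ▸ Submodule.mem_top
    induction hv using Submodule.span_induction with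
    | mem x hx => obtain ⟨y, rfl⟩ := hx; exact hc y
    | zero => simp
    | add x y _ _ hx hy => rw [add_dotProduct, hx, hy, add_zero]
    | smul a x _ hx => rw [smul_dotProduct, hx, smul_zero]
  exact dotProduct_eq_zero c fun v => (dotProduct_comm _ _).trans (hall v)

theorem nonempty_rationalComponents {P : ℂ[X][Y]} (hP : P.Monic) {m n : ℕ} (hm : m ≠ 0)
    (hn : P.natDegree = n) (br : Fin n → Branch P m)
    (hbr : Function.Injective fun k => (br k).value)
    (hcomp : ∀ (f : ℂ[X][Y]) (hf : Irreducible f), f ∣ P →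
      singularSet f = ∅ ∧ curveGenus f hf = 0) :
    ∃ k, Nonempty (RationalComponents P m k) := by
  classical
  obtain ⟨k, f, hf, hprod⟩ := exists_monic_irreducible_factors P hP
  have hdvd : ∀ i, f i ∣ P := fun i => hprod ▸ Finset.dvd_prod_of_mem f (Finset.mem_univ i)
  have hex : ∀ l, ∃ i, (f i).eval₂ (atInfinity : ℂ[X] →+* ℂ⸨X⸩)
      (param⁻¹ ^ m * toLaurent (br l).nu) = 0 := fun l => by
    have h := (br l).isRoot
    generalize param⁻¹ ^ m * toLaurent (br l).nu = x at h
    rw [hprod, eval₂_finsetProd, Finset.prod_eq_zero_iff] at h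
    obtain ⟨i, -, hi⟩ := h
    exact ⟨i, hi⟩
  choose c hc using hex
  let κ : Fin k → Type := fun i => {l : Fin n // c l = i}
  let b : ∀ i, κ i → Branch (f i) m := fun i l => ⟨(br l.1).nu, by
    have := hc l.1
    rwa [l.2] at this⟩
  have hinj : Function.Injective fun x : Σ i, κ i => (b x.1 x.2).value := by
    rintro ⟨i, l, rfl⟩ ⟨j, l', rfl⟩ h
    have : l = l' := hbr h
    subst this
    rfl
  have hle : ∀ i, Fintype.card (κ i) ≤ (f i).natDegree := fun i => by
    by_contra! hlt
    refine ((hf i).1.map (atInfinity : ℂ[X] →+* ℂ⸨X⸩)).ne_zero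
      (eq_zero_of_natDegree_lt_card_of_eval_eq_zero _
        (f := fun l : κ i => param⁻¹ ^ m * toLaurent (b i l).nu) (fun l l' h => ?_) (fun l => ?_)
        (by rwa [(hf i).1.natDegree_map]))
    · have := @hinj ⟨i, l⟩ ⟨i, l'⟩ (eq_of_root_eq (β := b i l) (γ := b i l') h)
      simpa using this
    · rw [eval_map]
      exact (b i l).isRoot
  -- Each branch lies on some component, and no component has more branches than its degree. Both
  -- totals are `n`, so equality holds on every component.
  have hsum : ∑ i, Fintype.card (κ i) = ∑ i, (f i).natDegree := by
    rw [← natDegree_prod_of_monic _ _ fun i _ => (hf i).1, ← hprod, hn, ← Fintype.card_sigma,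
      Fintype.card_congr (Equiv.sigmaFiberEquiv c), Fintype.card_fin]
  have hcard : ∀ i, Fintype.card (κ i) = (f i).natDegree := fun i =>
    (Finset.sum_eq_sum_iff_of_le fun i _ => hle i).1 hsum i (Finset.mem_univ i)
  have hdom : ∀ i, IsDomain (AdjoinRoot (f i)) := fun i =>
    AdjoinRoot.isDomain_of_prime (hf i).2.prime
  have hne : ∀ i, Nonempty (κ i) := fun i => by
    rw [← Fintype.card_pos_iff, hcard]
    exact (hf i).1.natDegree_pos.2 fun h => (hf i).2.not_isUnit (h ▸ isUnit_one)
  have hT : ∀ i, Nonempty (Coordinate (b i) (hne i).some) := fun i =>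
    nonempty_coordinate (hf i).1 hm (hcomp _ (hf i).2 (hdvd i)).1 (hcomp _ (hf i).2 (hdvd i)).2
      (fun l l' h => by
        have := @hinj ⟨i, l⟩ ⟨i, l'⟩ h
        simpa using this) (hcard i)
  exact ⟨k, ⟨⟨f, fun i => (hf i).1, hdom, hprod, κ, inferInstance, b, hcard, hinj,
    fun i => (hne i).some, fun i => (hT i).some⟩⟩⟩

section

variable {P : ℂ[X][Y]} {n m k : ℕ} (D : RationalComponents P m k)
  {B : Matrix (Fin n) (Fin n) ℂ} {L : Matrix (Fin n) (Fin n) ℂ[X]}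

namespace RationalComponents

theorem injective_value (i : Fin k) : Function.Injective fun l => (D.br i l).value :=
  fun l l' h => by
    have := @D.value_injective ⟨i, l⟩ ⟨i, l'⟩ h
    simpa using this

theorem nonempty_eigenRow (hm : m ≠ 0) (hL : L.charpoly = P) (i : Fin k) :
    Nonempty (EigenRow L (D.T i)) :=
  Spectral.nonempty_eigenRow (D.monic i) hm (D.injective_value i) (D.card_eq i)
    ((Finset.dvd_prod_of_mem D.f (Finset.mem_univ i)).trans
      (dvd_of_eq (D.prod_eq.symm.trans hL.symm)))

theorem card_sigma_eq (hL : L.charpoly = P) : Fintype.card (Σ i, D.κ i) = n := by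
  rw [Fintype.card_sigma, Finset.sum_congr rfl fun i _ => D.card_eq i,
    ← natDegree_prod_of_monic _ _ fun i _ => D.monic i, ← D.prod_eq, ← hL,
    Matrix.charpoly_natDegree_eq_dim, Fintype.card_fin]

variable {D}

/-- A vector whose pairings with the eigenvectors have minimal poles at infinity is constant. -/
theorem exists_C_of_pairing_eq (hdeg : ∀ i j, (L i j).natDegree ≤ m)
    (hcoeff : matrixCoeff L m = B) (hL : L.charpoly = P) (R : ∀ i, EigenRow L (D.T i))
    (c : Fin n → ℂ[X]) (u : Fin k → ℂ[X]) (hu : ∀ i, (u i).natDegree ≤ (R i).N)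
    (hc : ∀ i, (R i).pairing c = aeval (D.T i).t (u i)) : ∃ a : Fin n → ℂ, ∀ j, c j = C (a j) := by
  classical
  choose y hy hy0 using fun x : Σ i, D.κ i => (D.T x.1).exists_leading_vector (R x.1).g
    (R x.1).natDegree_le (R x.1).exists_coeff_ne_zero (R x.1).coprime x.2
  obtain ⟨M, hM0, hM⟩ := exists_powerSeries_matrix hdeg hcoeff
  -- The eigenvector equation in expansions normalized to be finite and nonzero at infinity; the
  -- factor `s ^ m` of `M` cancels the pole of `μ`.
  have heig : ∀ x l, ∑ j, y x j * M j l = (D.br x.1 x.2).nu * y x l := by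
    rintro ⟨i, κ⟩ l
    apply toLaurent_injective
    have h1 := congrArg (D.br i κ).hom ((R i).eigen l)
    simp only [map_sum, map_mul, Algebra.smul_def, AdjoinRoot.algebraMap_eq, Branch.hom_of,
      Branch.hom_root] at h1
    rw [map_sum, map_mul, hy]
    simp only [map_mul, hy, hM]
    have h2 : (param ^ m * param⁻¹ ^ m : ℂ⸨X⸩) = 1 := by
      rw [← mul_pow, mul_inv_cancel₀ param_ne_zero, one_pow]
    calc _ = param ^ m * param ^ (D.T i).poleOrder (R i).N κ *
          ∑ j, atInfinity (L j l) * (D.br i κ).hom (aeval (D.T i).t ((R i).g j)) := by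
          rw [Finset.mul_sum]
          exact Finset.sum_congr rfl fun j _ => by ring
      _ = _ := by
        rw [h1]
        linear_combination (param ^ (D.T i).poleOrder (R i).N κ * toLaurent (D.br i κ).nu *
          (D.br i κ).hom (aeval (D.T i).t ((R i).g l))) * h2
  -- At `s = 0` the rows are eigenrows of `B` for its `n` distinct eigenvalues, so the system is
  -- nondegenerate. The right hand sides are regular because `deg u_i ≤ N_i`.
  have hreg := regular_of_mulVec_regular (Matrix.of y) (fun a ha => ?_)
    (fun j => atInfinity (c j)) (fun x => ?_)
  · choose a ha using fun j => exists_C_of_atInfinity_mem (hreg j)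
    exact ⟨a, ha⟩
  · refine eq_zero_of_eigenRows (B := B) (D.card_sigma_eq hL) D.value_injective
      (w := fun x j => PowerSeries.constantCoeff (y x j)) (fun x h => ?_) (fun x => ?_) a ha
    · obtain ⟨j, hj⟩ := hy0 x
      exact hj (congrFun h j)
    · funext l
      have := congrArg PowerSeries.constantCoeff (heig x l)
      rw [map_sum, map_mul] at this
      simp only [Matrix.vecMul, dotProduct, ← hM0, Matrix.map_apply, Pi.smul_apply, smul_eq_mul]
      simpa only [map_mul, Branch.value] using this
  · have h1 := (D.T x.1).param_pow_mul_mem_regular (u x.1) (hu x.1) x.2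
    rw [← hc x.1, EigenRow.pairing_apply, map_sum, Finset.mul_sum] at h1
    convert! h1 using 2 with j
    rw [Matrix.of_apply, hy, Algebra.smul_def, map_mul, AdjoinRoot.algebraMap_eq, Branch.hom_of]
    ring

/-- All pairings of `c` and of `λ c` vanish, so both vectors are constant, which is possible only
for `c = 0`. -/
theorem eq_zero_of_pairing_eq_zero (hdeg : ∀ i j, (L i j).natDegree ≤ m)
    (hcoeff : matrixCoeff L m = B) (hL : L.charpoly = P) (R : ∀ i, EigenRow L (D.T i))
    (c : Fin n → ℂ[X]) (hc : ∀ i, (R i).pairing c = 0) : c = 0 := by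
  obtain ⟨a, ha⟩ := exists_C_of_pairing_eq hdeg hcoeff hL R c 0 (by simp) (by simpa using hc)
  obtain ⟨b, hb⟩ := exists_C_of_pairing_eq hdeg hcoeff hL R ((X : ℂ[X]) • c) 0 (by simp)
    (fun i => by rw [map_smul, hc i]; simp)
  funext j
  have h := hb j
  rw [Pi.smul_apply, smul_eq_mul, ha j] at h
  have := congrArg (fun p => p.coeff 1) h
  simp only [coeff_X_mul, coeff_C_zero, coeff_C_succ] at this
  rw [ha j, this, C_0, Pi.zero_apply]

theorem pairing_C (i : Fin k) (R : EigenRow L (D.T i)) (a : Fin n → ℂ) :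
    R.pairing (fun j => C (a j)) = aeval (D.T i).t (∑ j, C (a j) * R.g j) := by
  rw [EigenRow.pairing_apply, map_sum]
  refine Finset.sum_congr rfl fun j _ => ?_
  rw [map_mul, aeval_C, Algebra.smul_def, IsScalarTower.algebraMap_apply ℂ ℂ[X] (AdjoinRoot _)]
  rfl

/-- Solvability of the interpolation problem in constant vectors. -/
theorem exists_constant_solution (hdeg : ∀ i j, (L i j).natDegree ≤ m)
    (hcoeff : matrixCoeff L m = B) (hL : L.charpoly = P) (R : ∀ i, EigenRow L (D.T i))
    (hsurj : ∀ u : ∀ i, AdjoinRoot (D.f i), ∃ c, ∀ i, (R i).pairing c = u i)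
    (u : Fin k → ℂ[X]) (hu : ∀ i, (u i).natDegree ≤ (R i).N) :
    ∃ a : Fin n → ℂ, ∀ i, ∑ j, C (a j) * (R i).g j = u i := by
  obtain ⟨c, hc⟩ := hsurj fun i => aeval (D.T i).t (u i)
  obtain ⟨a, ha⟩ := exists_C_of_pairing_eq hdeg hcoeff hL R c u hu hc
  obtain rfl : c = fun j => C (a j) := funext ha
  exact ⟨a, fun i => (D.T i).aeval_injective ((pairing_C i (R i) a).symm.trans (hc i))⟩

/-- The degree of the eigenvector on each component. -/
theorem N_succ_eq_natDegree (hdeg : ∀ i j, (L i j).natDegree ≤ m)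
    (hcoeff : matrixCoeff L m = B) (hL : L.charpoly = P) (R : ∀ i, EigenRow L (D.T i))
    (hsurj : ∀ u : ∀ i, AdjoinRoot (D.f i), ∃ c, ∀ i, (R i).pairing c = u i) (i : Fin k) :
    (D.f i).natDegree = (R i).N + 1 := by
  -- `M` maps a constant vector to the coefficients of its pairings. Its surjectivity gives `∑ (N_i
  -- + 1) ≤ n = ∑ deg f_i`, while `deg f_i ≤ N_i + 1` holds for each `i`.
  let M : Matrix (Σ i, Fin ((R i).N + 1)) (Fin n) ℂ := Matrix.of fun x j => ((R x.1).g j).coeff x.2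
  have hM : Function.Surjective M.mulVecLin := by
    intro v
    obtain ⟨a, ha⟩ := exists_constant_solution hdeg hcoeff hL R hsurj
      (fun i => ∑ e : Fin ((R i).N + 1), C (v ⟨i, e⟩) * X ^ (e : ℕ)) fun i =>
        natDegree_sum_le_of_forall_le _ _ fun e _ =>
          (natDegree_C_mul_X_pow_le _ _).trans (by omega)
    refine ⟨a, ?_⟩
    funext ⟨i, e⟩
    have := congrArg (fun p => p.coeff e) (ha i)
    simp only [finsetSum_coeff, coeff_C_mul, coeff_X_pow, Fin.val_inj] at this
    rw [Matrix.mulVecLin_apply, Matrix.mulVec, dotProduct]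
    simp only [M, Matrix.of_apply]
    simpa [mul_comm] using this
  have hle := LinearMap.finrank_le_finrank_of_surjective hM
  rw [Module.finrank_fintype_fun_eq_card, Module.finrank_fintype_fun_eq_card, Fintype.card_fin,
    Fintype.card_sigma] at hle
  simp only [Fintype.card_fin] at hle
  have hn : n = ∑ i, (D.f i).natDegree := by
    conv_lhs => rw [← D.card_sigma_eq hL]
    rw [Fintype.card_sigma, Finset.sum_congr rfl fun i _ => D.card_eq i]
  have hle' : ∀ i ∈ Finset.univ, (D.f i).natDegree ≤ (R i).N + 1 := fun i _ =>
    (R i).natDegree_le_succ (D.monic i)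
  exact (Finset.sum_eq_sum_iff_of_le hle').1
    (le_antisymm (Finset.sum_le_sum hle') (hn ▸ hle)) i (Finset.mem_univ i)

end RationalComponents

end

/-! ### Independence of the pairings and conjugation by a constant matrix -/

section

variable {n m k : ℕ} {B : Matrix (Fin n) (Fin n) ℂ} {τ : ℂ → ℂ} {σ : ℂ}
  {L L' : Matrix (Fin n) (Fin n) ℂ[X]} {P : ℂ[X][Y]} {D : RationalComponents P m k}

namespace RationalComponents

/-- When the spectral projectors are polynomial in `λ`, the pairings with the eigenvectors on the
components of the spectral curve can be prescribed independently. -/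
theorem exists_pairing_eq (R : ∀ i, EigenRow L (D.T i))
    (hproj : ∀ i, ∃ (E : Matrix (Fin n) (Fin n) ℂ[X]) (a b : ℂ[X][Y]) (r : ℂ[X]), r ≠ 0 ∧
      a * D.f i + b * ∏ j ∈ Finset.univ.erase i, D.f j = C r ∧
      aeval L (b * ∏ j ∈ Finset.univ.erase i, D.f j) = r • E)
    (u : ∀ i, AdjoinRoot (D.f i)) : ∃ c, ∀ i, (R i).pairing c = u i := by
  classical
  choose E a b r hr hab hE using hproj
  have hne : ∀ i j, AdjoinRoot.of (D.f j) (r i) ≠ 0 := fun i j h => by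
    have := congrArg (D.br j (D.k₀ j)).hom h
    rw [Branch.hom_of, map_zero] at this
    exact hr i (atInfinity_injective (this.trans (map_zero _).symm))
  -- Under the pairing with the component `j`, `r E_i` acts as `b h`. This is `r` modulo `f_i`, and
  -- `0` modulo `f_j` for `j ≠ i`, because `f_j` divides `h`.
  have key : ∀ i j c, AdjoinRoot.of (D.f j) (r i) * (R j).pairing (E i *ᵥ c) =
      AdjoinRoot.mk (D.f j) (b i * ∏ j ∈ Finset.univ.erase i, D.f j) * (R j).pairing c :=
    fun i j c => by
      rw [← EigenRow.pairing_aeval_mulVec, hE, Matrix.smul_mulVec, map_smul, Algebra.smul_def,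
        AdjoinRoot.algebraMap_eq]
  have hsame : ∀ i c, (R i).pairing (E i *ᵥ c) = (R i).pairing c := fun i c => by
    apply mul_left_cancel₀ (hne i i)
    rw [key]
    congr 1
    have := congrArg (AdjoinRoot.mk (D.f i)) (hab i)
    rwa [map_add, map_mul, AdjoinRoot.mk_self, mul_zero, zero_add, AdjoinRoot.mk_C] at this
  have hother : ∀ i j c, j ≠ i → (R j).pairing (E i *ᵥ c) = 0 := fun i j c hij => by
    apply mul_left_cancel₀ (hne i j)
    rw [key, mul_zero, AdjoinRoot.mk_eq_zero.2, zero_mul]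
    exact (Finset.dvd_prod_of_mem D.f (Finset.mem_erase.2 ⟨hij, Finset.mem_univ j⟩)).mul_left _
  choose c hc using fun i => (R i).pairing_surjective (u i)
  refine ⟨∑ i, E i *ᵥ c i, fun j => ?_⟩
  rw [map_sum, Finset.sum_eq_single j (fun i _ hij => hother i j _ hij.symm) (by simp), hsame, hc]

theorem exists_pairing_eq_of_mem_realPencils (hτ : IsAntiholomorphicInvolution τ) (hσ : ‖σ‖ = 1)
    (hm : m ≠ 0) (hB : B ≠ 0) (hLr : L ∈ realPencils m B τ σ) (hL : L.charpoly = P)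
    (hsing : singularSet (spectralPoly L) ⊆ Function.fixedPoints (tauHat τ σ))
    (hsep : ∃ r : ℂ[X], r ≠ 0 ∧ C r ∈ Ideal.span {P, derivative P})
    (R : ∀ i, EigenRow L (D.T i)) (u : ∀ i, AdjoinRoot (D.f i)) :
    ∃ c, ∀ i, (R i).pairing c = u i := by
  refine exists_pairing_eq R (fun i => ?_) u
  have hP : P = D.f i * ∏ j ∈ Finset.univ.erase i, D.f j :=
    D.prod_eq.trans (Finset.mul_prod_erase _ _ (Finset.mem_univ i)).symm
  exact exists_polynomial_projector hτ hσ hm hB hLr hsing (hL.trans hP)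
    (exists_C_mem_span_of_mul hP hsep)

/-- The `j`-th column of `Q` is a constant vector whose pairings for `L` are the `j`-th entries of
the eigenrows for `L'`. -/
theorem exists_transition (hdeg : ∀ i j, (L i j).natDegree ≤ m) (hcoeff : matrixCoeff L m = B)
    (hL : L.charpoly = P) (R : ∀ i, EigenRow L (D.T i)) (R' : ∀ i, EigenRow L' (D.T i))
    (hsurj : ∀ u : ∀ i, AdjoinRoot (D.f i), ∃ c, ∀ i, (R i).pairing c = u i)
    (hN : ∀ i, (R' i).N ≤ (R i).N) :
    ∃ Q : Matrix (Fin n) (Fin n) ℂ, ∀ i c, (R i).pairing (Q.map C *ᵥ c) = (R' i).pairing c := by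
  choose q hq using fun j => exists_constant_solution hdeg hcoeff hL R hsurj
    (fun i => (R' i).g j) fun i => ((R' i).natDegree_le j).trans (hN i)
  refine ⟨Matrix.of fun l j => q j l, fun i c => ?_⟩
  have hcol : (Matrix.of fun l j => q j l).map C *ᵥ c =
      ∑ j, c j • fun l => (C (q j l) : ℂ[X]) := by
    funext l
    rw [Finset.sum_apply]
    simp only [Matrix.mulVec, dotProduct, Matrix.map_apply, Matrix.of_apply, Pi.smul_apply,
      smul_eq_mul]
    exact Finset.sum_congr rfl fun j _ => mul_comm _ _
  rw [hcol, map_sum, EigenRow.pairing_apply]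
  refine Finset.sum_congr rfl fun j _ => ?_
  rw [map_smul, pairing_C, hq]

theorem eq_of_pairing_mulVec_eq (hdeg : ∀ i j, (L i j).natDegree ≤ m)
    (hcoeff : matrixCoeff L m = B) (hL : L.charpoly = P) (R : ∀ i, EigenRow L (D.T i))
    {M N : Matrix (Fin n) (Fin n) ℂ[X]}
    (h : ∀ i c, (R i).pairing (M *ᵥ c) = (R i).pairing (N *ᵥ c)) : M = N := by
  have : ∀ c, M *ᵥ c = N *ᵥ c := fun c => sub_eq_zero.1
    (eq_zero_of_pairing_eq_zero hdeg hcoeff hL R _ fun i => by rw [map_sub, h, sub_self])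
  exact Matrix.mulVec_injective (funext this)

/-- Two matrix polynomials with the same rational spectral curve are conjugate by a constant
matrix. -/
theorem exists_conjugation (hdeg : ∀ i j, (L i j).natDegree ≤ m) (hcoeff : matrixCoeff L m = B)
    (hL : L.charpoly = P) (hdeg' : ∀ i j, (L' i j).natDegree ≤ m)
    (hcoeff' : matrixCoeff L' m = B) (hL' : L'.charpoly = P)
    (R : ∀ i, EigenRow L (D.T i)) (R' : ∀ i, EigenRow L' (D.T i))
    (hsurj : ∀ u : ∀ i, AdjoinRoot (D.f i), ∃ c, ∀ i, (R i).pairing c = u i)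
    (hsurj' : ∀ u : ∀ i, AdjoinRoot (D.f i), ∃ c, ∀ i, (R' i).pairing c = u i) :
    ∃ Q : Matrix (Fin n) (Fin n) ℂ, IsUnit Q ∧ Q.map C * L' = L * Q.map C := by
  -- Both degrees equal `deg f_i - 1`, so transition matrices exist in both directions and are
  -- inverse to each other.
  have hN : ∀ i, (R i).N = (R' i).N := fun i => by
    have h1 := N_succ_eq_natDegree hdeg hcoeff hL R hsurj i
    have h2 := N_succ_eq_natDegree hdeg' hcoeff' hL' R' hsurj' i
    omega
  obtain ⟨Q, hQ⟩ := exists_transition hdeg hcoeff hL R R' hsurj fun i => (hN i).ge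
  obtain ⟨Q', hQ'⟩ := exists_transition hdeg' hcoeff' hL' R' R hsurj' fun i => (hN i).le
  refine ⟨Q, ?_, ?_⟩
  · have h1 : Q.map C * Q'.map C = (1 : Matrix (Fin n) (Fin n) ℂ[X]) :=
      eq_of_pairing_mulVec_eq hdeg hcoeff hL R fun i c => by
        rw [← Matrix.mulVec_mulVec, hQ, hQ', Matrix.one_mulVec]
    have h2 : Q * Q' = 1 := by
      apply Matrix.map_injective (C_injective (R := ℂ))
      change (Q * Q').map C = (1 : Matrix (Fin n) (Fin n) ℂ).map C
      rw [Matrix.map_mul, h1, Matrix.map_one _ C_0 C_1]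
    exact IsUnit.of_mul_eq_one _ h2
  · refine eq_of_pairing_mulVec_eq hdeg hcoeff hL R fun i c => ?_
    rw [← Matrix.mulVec_mulVec, ← Matrix.mulVec_mulVec, hQ, EigenRow.pairing_mulVec,
      EigenRow.pairing_mulVec, hQ]

end RationalComponents

/-! ### From constant to unitary conjugation -/

theorem evalAt_map_C (Q : Matrix (Fin n) (Fin n) ℂ) (z : ℂ) : evalAt (Q.map C) z = Q := by
  ext i j
  simp [evalAt]

theorem evalAt_mul (M N : Matrix (Fin n) (Fin n) ℂ[X]) (z : ℂ) :
    evalAt (M * N) z = evalAt M z * evalAt N z := by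
  rw [evalAt_eq_mapMatrix, map_mul]
  rfl

theorem ext_evalAt {M N : Matrix (Fin n) (Fin n) ℂ[X]} (h : ∀ z, evalAt M z = evalAt N z) :
    M = N := by
  ext1 i j
  exact Polynomial.funext fun z => congrFun (congrFun (h z) i) j

theorem matrixCoeff_map_C_mul (Q : Matrix (Fin n) (Fin n) ℂ) (M : Matrix (Fin n) (Fin n) ℂ[X])
    (k : ℕ) : matrixCoeff (Q.map C * M) k = Q * matrixCoeff M k := by
  ext i j
  simp [matrixCoeff, Matrix.mul_apply, finsetSum_coeff]

theorem matrixCoeff_mul_map_C (M : Matrix (Fin n) (Fin n) ℂ[X]) (Q : Matrix (Fin n) (Fin n) ℂ)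
    (k : ℕ) : matrixCoeff (M * Q.map C) k = matrixCoeff M k * Q := by
  ext i j
  simp [matrixCoeff, Matrix.mul_apply, finsetSum_coeff]

open scoped ComplexOrder in
/-- The unitary part of an invertible matrix `Q`: it is of the form `Q S⁻¹`, where `S` commutes with
everything that commutes with `Qᴴ Q`. -/
theorem exists_unitary_of_isUnit {Q : Matrix (Fin n) (Fin n) ℂ} (hQ : IsUnit Q) :
    ∃ U ∈ Matrix.unitaryGroup (Fin n) ℂ, ∃ S : Matrix (Fin n) (Fin n) ℂ, Q = U * S ∧ IsUnit S ∧
      ∀ M, Commute (Qᴴ * Q) M → Commute S M := by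
  set H := Qᴴ * Q with hH
  have hps : H.PosSemidef := Matrix.posSemidef_conjTranspose_mul_self Q
  have hsa : IsSelfAdjoint H := hps.isHermitian
  have hspec := (Matrix.posSemidef_iff_isHermitian_and_spectrum_nonneg.1 hps).2
  set S := cfc Real.sqrt H with hS
  have hSS : S * S = H := by
    rw [hS, ← cfc_mul Real.sqrt Real.sqrt H]
    conv_rhs => rw [← cfc_id ℝ H]
    refine cfc_congr fun x hx => Real.mul_self_sqrt ?_
    have : (x : ℂ) ∈ spectrum ℂ H := by
      have h1 := spectrum.algebraMap_mem (S := ℂ) hx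
      exact h1
    have h2 : (0 : ℂ) ≤ (x : ℂ) := hspec this
    exact_mod_cast h2
  have hSsa : Sᴴ = S := (cfc_predicate Real.sqrt H : IsSelfAdjoint S)
  have hHu : IsUnit H := hQ.star.mul hQ
  have hSu : IsUnit S := isUnit_of_mul_isUnit_left (hSS ▸ hHu)
  have hdet : IsUnit S.det := (Matrix.isUnit_iff_isUnit_det S).1 hSu
  refine ⟨Q * S⁻¹, ?_, S, ?_, hSu, fun M hM => hsa.commute_cfc hM _⟩
  · rw [Matrix.mem_unitaryGroup_iff', Matrix.star_eq_conjTranspose, Matrix.conjTranspose_mul,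
      Matrix.conjTranspose_nonsing_inv, hSsa, mul_assoc, ← mul_assoc Qᴴ, ← hH, ← hSS,
      mul_assoc S, Matrix.mul_nonsing_inv _ hdet, mul_one, Matrix.nonsing_inv_mul _ hdet]
  · rw [mul_assoc, Matrix.nonsing_inv_mul _ hdet, mul_one]

/-- Matrix polynomials satisfying the reality condition that are conjugate by a constant matrix
are conjugate by a unitary matrix. -/
theorem exists_unitary_conjugation (hσ : ‖σ‖ = 1) (hL : L ∈ realPencils m B τ σ)
    (hL' : L' ∈ realPencils m B τ σ) {Q : Matrix (Fin n) (Fin n) ℂ} (hQ : IsUnit Q)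
    (h : Q.map C * L' = L * Q.map C) :
    ∃ U ∈ Matrix.unitaryGroup (Fin n) ℂ, U.map C * L' = L * U.map C := by
  have hσ0 : σ ≠ 0 := fun h0 => by simp [h0] at hσ
  have hz : ∀ z, Q * evalAt L' z = evalAt L z * Q := fun z => by
    have := congrArg (fun M => evalAt M z) h
    simpa only [evalAt_mul, evalAt_map_C] using this
  -- Reading the conjugation at `τ z` and taking adjoints gives `L'_z Qᴴ = Qᴴ L_z`, hence `Qᴴ Q L'_z
  -- = Qᴴ L_z Q = L'_z Qᴴ Q`.
  have hcomm : ∀ z, Commute (Qᴴ * Q) (evalAt L' z) := fun z => by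
    have h1 := hz (τ z)
    rw [hL.2.2, hL'.2.2, Matrix.mul_smul, Matrix.smul_mul] at h1
    have h2 := smul_right_injective _ hσ0 h1
    have h3 := congrArg Matrix.conjTranspose h2
    simp only [Matrix.conjTranspose_mul, Matrix.conjTranspose_conjTranspose] at h3
    change Qᴴ * Q * _ = _ * (Qᴴ * Q)
    rw [mul_assoc, hz, ← mul_assoc, ← h3, mul_assoc]
  obtain ⟨U, hU, S, rfl, hSu, hS⟩ := exists_unitary_of_isUnit hQ
  refine ⟨U, hU, ext_evalAt fun z => ?_⟩
  rw [evalAt_mul, evalAt_mul, evalAt_map_C]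
  apply hSu.mul_right_cancel
  have h1 := hz z
  rw [mul_assoc, (hS _ (hcomm z)).eq, ← mul_assoc, ← mul_assoc] at h1
  exact h1

theorem gaugeOrbit_subset (hL : L ∈ realPencils m B τ σ) :
    gaugeOrbit B L ⊆ isospectralSet m B τ σ L := by
  rintro _ ⟨Q, hQ, hQB, rfl⟩
  have hdet : IsUnit Q.det := Matrix.UnitaryGroup.det_isUnit ⟨Q, hQ⟩
  have hstar : Q⁻¹ = Qᴴ := Matrix.inv_eq_left_inv (Matrix.mem_unitaryGroup_iff'.1 hQ)
  have hinv : Q⁻¹ * Q = 1 := Matrix.nonsing_inv_mul _ hdet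
  have hev : ∀ z, evalAt ((Q⁻¹).map C * L * Q.map C) z = Q⁻¹ * evalAt L z * Q := fun z => by
    rw [evalAt_mul, evalAt_mul, evalAt_map_C, evalAt_map_C]
  refine ⟨⟨fun k hk => ?_, ?_, fun z => ?_⟩, ?_⟩
  · rw [matrixCoeff_mul_map_C, matrixCoeff_map_C_mul, hL.1 k hk, mul_zero, zero_mul]
  · rw [matrixCoeff_mul_map_C, matrixCoeff_map_C_mul, hL.2.1, mul_assoc, ← hQB.eq, ← mul_assoc,
      hinv, one_mul]
  · rw [hev, hev, hL.2.2, hstar, Matrix.conjTranspose_mul, Matrix.conjTranspose_mul,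
      Matrix.conjTranspose_conjTranspose, Matrix.mul_smul, Matrix.smul_mul, mul_assoc]
  · have hchar : ((Q⁻¹).map C * L * Q.map C).charpoly = L.charpoly := by
      have h1 : (Q⁻¹).map C * Q.map C = (1 : Matrix (Fin n) (Fin n) ℂ[X]) := by
        rw [← Matrix.map_mul, hinv, Matrix.map_one _ C_0 C_1]
      rw [mul_assoc, Matrix.charpoly_mul_comm, mul_assoc, mul_eq_one_comm.1 h1, mul_one]
    rw [spectralCurve, spectralCurve, spectralPoly_eq, spectralPoly_eq, hchar]

theorem zeroSet_spectralPoly : zeroSet (spectralPoly L) = zeroSet L.charpoly := by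
  ext p
  simp [zeroSet, spectralPoly_eq, evalEval_mul, evalEval_pow]

theorem mem_gaugeOrbit_of_unitary {U : Matrix (Fin n) (Fin n) ℂ}
    (hU : U ∈ Matrix.unitaryGroup (Fin n) ℂ) (hcoeff : matrixCoeff L m = B)
    (hcoeff' : matrixCoeff L' m = B) (h : U.map C * L' = L * U.map C) : L' ∈ gaugeOrbit B L := by
  have hdet : IsUnit U.det := Matrix.UnitaryGroup.det_isUnit ⟨U, hU⟩
  refine ⟨U, hU, ?_, ?_⟩
  · have := congrArg (fun M => matrixCoeff M m) h
    simp only [matrixCoeff_map_C_mul, matrixCoeff_mul_map_C, hcoeff, hcoeff'] at this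
    exact this
  · rw [mul_assoc, ← h, ← mul_assoc, ← Matrix.map_mul, Matrix.nonsing_inv_mul _ hdet,
      Matrix.map_one _ C_0 C_1, one_mul]

/-! ### The curve determines the characteristic polynomial; degenerate cases -/

theorem exists_C_mem_span_derivative_charpoly (hB : B.charpoly.roots.Nodup)
    (hL : L ∈ realPencils m B τ σ) :
    ∃ r : ℂ[X], r ≠ 0 ∧ C r ∈ Ideal.span {L.charpoly, derivative L.charpoly} := by
  obtain ⟨br, hbr⟩ := exists_branches (natDegree_le_of_mem_realPencils hL) hL.2.1 hB
  exact exists_C_mem_span_derivative _ atInfinity_injective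
    (separable_map_of_branches L.charpoly_monic
      (by rw [Matrix.charpoly_natDegree_eq_dim, Fintype.card_fin]) br hbr)

theorem charpoly_eq_of_spectralCurve_eq (hB : B.charpoly.roots.Nodup)
    (hL : L ∈ realPencils m B τ σ) (hL' : L' ∈ realPencils m B τ σ)
    (h : spectralCurve L = spectralCurve L') : L.charpoly = L'.charpoly := by
  refine eq_of_zeroSet_eq L.charpoly_monic L'.charpoly_monic
    (exists_C_mem_span_derivative_charpoly hB hL)
    (exists_C_mem_span_derivative_charpoly hB hL') ?_
  rwa [spectralCurve, spectralCurve, zeroSet_spectralPoly, zeroSet_spectralPoly] at h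

theorem eq_of_mem_realPencils_zero (hL : L ∈ realPencils 0 B τ σ)
    (hL' : L' ∈ realPencils 0 B τ σ) : L = L' := by
  ext i j k
  rcases Nat.eq_zero_or_pos k with rfl | hk
  · exact congrFun (congrFun (hL.2.1.trans hL'.2.1.symm) i) j
  · exact congrFun (congrFun ((hL.1 k hk).trans (hL'.1 k hk).symm) i) j

theorem le_one_of_nodup_roots_charpoly_zero
    (h : (0 : Matrix (Fin n) (Fin n) ℂ).charpoly.roots.Nodup) : n ≤ 1 := by
  have := Multiset.nodup_iff_count_le_one.1 h 0
  rwa [Matrix.charpoly_zero, Fintype.card_fin, roots_pow, roots_X, Multiset.count_nsmul,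
    Multiset.count_singleton_self, mul_one] at this

theorem eq_of_charpoly_eq_of_le_one (hn : n ≤ 1) (h : L.charpoly = L'.charpoly) : L = L' := by
  obtain rfl | rfl : n = 0 ∨ n = 1 := by omega
  · exact Subsingleton.elim _ _
  · have htr : L.trace = L'.trace := by
      rw [Matrix.trace_eq_neg_charpoly_coeff, Matrix.trace_eq_neg_charpoly_coeff, h]
    ext1 i j
    rw [Matrix.trace_fin_one, Matrix.trace_fin_one] at htr
    rwa [Subsingleton.elim i 0, Subsingleton.elim j 0]

end

end Spectral

end

open Spectral in
theorem lemma1 (m n : ℕ) (B : Matrix (Fin n) (Fin n) ℂ) (τ : ℂ → ℂ) (σ : ℂ)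
    (hτ : Spectral.IsAntiholomorphicInvolution τ) (hσ : ‖σ‖ = 1)
    (hB : B.charpoly.roots.Nodup)
    (L₀ : Matrix (Fin n) (Fin n) (Polynomial ℂ)) (hL₀ : L₀ ∈ Spectral.realPencils m B τ σ)
    (hsing : Spectral.singularSet (Spectral.spectralPoly L₀) ⊆
      Function.fixedPoints (Spectral.tauHat τ σ))
    (hcomp : ∀ (f : Polynomial (Polynomial ℂ)) (hf : Spectral.IsComponent L₀ f),
      Spectral.singularSet f = ∅ ∧ Spectral.curveGenus f hf.1 = 0)
    (hint : ∀ f g : Polynomial (Polynomial ℂ),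
      Spectral.IsComponent L₀ f → Spectral.IsComponent L₀ g → ¬ Associated f g →
      ∀ p ∈ Spectral.zeroSet f ∩ Spectral.zeroSet g, Spectral.intersectionOrder f g p ≤ 2) :
    Spectral.isospectralSet m B τ σ L₀ = Spectral.gaugeOrbit B L₀ := by
  refine Set.Subset.antisymm ?_ (gaugeOrbit_subset hL₀)
  rintro L ⟨hL, hcurve⟩
  have hchar := charpoly_eq_of_spectralCurve_eq hB hL hL₀ hcurve
  suffices h : ∃ Q : Matrix (Fin n) (Fin n) ℂ, IsUnit Q ∧ Q.map C * L = L₀ * Q.map C by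
    obtain ⟨Q, hQ, h⟩ := h
    obtain ⟨U, hU, h⟩ := exists_unitary_conjugation hσ hL₀ hL hQ h
    exact mem_gaugeOrbit_of_unitary hU hL₀.2.1 hL.2.1 h
  by_cases hm : m = 0
  · subst hm
    exact ⟨1, isUnit_one, by
      rw [eq_of_mem_realPencils_zero hL hL₀, Matrix.map_one _ C_0 C_1, one_mul, mul_one]⟩
  -- The zero matrix has simple spectrum only for `n ≤ 1`, and then the trace determines `L`.
  by_cases hB0 : B = 0
  · subst hB0
    exact ⟨1, isUnit_one, by
      rw [eq_of_charpoly_eq_of_le_one (le_one_of_nodup_roots_charpoly_zero hB) hchar,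
        Matrix.map_one _ C_0 C_1, one_mul, mul_one]⟩
  have hdeg := natDegree_le_of_mem_realPencils hL
  have hdeg₀ := natDegree_le_of_mem_realPencils hL₀
  obtain ⟨br, hbr⟩ := exists_branches hdeg₀ hL₀.2.1 hB
  have hcomp' : ∀ (f : ℂ[X][Y]) (hf : Irreducible f), f ∣ L₀.charpoly →
      singularSet f = ∅ ∧ curveGenus f hf = 0 := fun f hf hdvd =>
    hcomp f ⟨hf, by rw [spectralPoly_eq]; exact hdvd.mul_left _⟩
  obtain ⟨k, ⟨D⟩⟩ := nonempty_rationalComponents L₀.charpoly_monic hm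
    (by rw [Matrix.charpoly_natDegree_eq_dim, Fintype.card_fin]) br hbr hcomp'
  have R₀ := fun i => (D.nonempty_eigenRow hm rfl i).some
  have R := fun i => (D.nonempty_eigenRow hm hchar i).some
  have hsep := exists_C_mem_span_derivative_charpoly hB hL₀
  have hsing' : singularSet (spectralPoly L) ⊆ Function.fixedPoints (tauHat τ σ) := by
    rwa [spectralPoly_eq, hchar, ← spectralPoly_eq]
  exact D.exists_conjugation hdeg₀ hL₀.2.1 rfl hdeg hL.2.1 hchar R₀ R
    (D.exists_pairing_eq_of_mem_realPencils hτ hσ hm hB0 hL₀ rfl hsing hsep R₀)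
    (D.exists_pairing_eq_of_mem_realPencils hτ hσ hm hB0 hL hchar hsing' hsep R)
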